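/- Let $\alpha\in(0,1)$, $p\in[1,2]$, $a_-,a_+,\lambda_-,\lambda_+>0$. Call a real random variable $\theta$ tempered stable if $$\mathbb E[e^{it\theta}]=\exp\Big(\int_{\mathbb R}\big(e^{itx}-1-i\kappa(x)tx\big)\,\lambda(dx)\Big),\qquad t\in\mathbb R,$$ where $\kappa(x)=1$ for $|x|<1$, $\kappa(x)=1/|x|$ for $|x|\ge 1$, and $$\lambda(dx)=a_-\frac{e^{-\lambda_-|x|}}{|x|^{1+\alpha}}\mathbf 1_{\{x<0\}}\,dx+a_+\frac{e^{-\lambda_+x}}{x^{1+\alpha}}\mathbf 1_{\{x>0\}}\,dx .$$ Let $(\omega_n)_{n\ge0}$ be a bounded sequence of positive reals, let $k_0>0$ and $k_n:=k_0\prod_{l=0}^{n-1}1/\omega_l$ for $n\ge1$, and assume $\sum_n k_n^\alpha<\infty$. Let $\theta_{1,n},\theta_{2,n}$ $(n\ge0)$ be independent tempered stable random variables with the above law. Then the series $\sum_{n\ge0}k_n(\theta_{1,n}+i\theta_{2,n})e_n$, where $(e_n)$ is the canonical basis, converges almost surely in the complex Banach space $E=\ell^p(\mathbb N)$ to an $E$-valued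 random variable; let $\mu$ be its law on $E$. Let $T$ be the bounded weighted backward shift on $E$ given by $Te_0=0$, $Te_{n+1}=\omega_ne_n$, and let $T^*$ be its adjoint on the continuous dual $E^*$, $\langle z,T^*y^*\rangle=\langle Tz,y^*\rangle$. For every $x^*\in E^*$ the function $t\mapsto\int_E e^{it\,\mathrm{Re}\langle z,x^*\rangle}\mu(dz)$ has no zero on $\mathbb R$; for a real function $f$ of the form $f(z)=\mathrm{Re}\langle z,x^*\rangle$, $x^*\in E^*$ (for instance $f=-\mathrm{Im}\langle\cdot,y^*\rangle$), let $\log\int_E e^{if}d\mu$ be the value at $t=1$ of the continuous branch of $t\mapsto\log\int_E e^{itf}d\mu$ that vanishes at $t=0$. For $x^*,y^*\in E^*$ define the codifferences $$C^=_\mu(x^*,y^*)=\log\int_E e^{i\mathrm{Re}\langle z,x^*-y^*\rangle}\mu(dz)-\log\int_E e^{i\mathrm{Re}\langle z,x^*\rangle}\mu(dz)-\log\int_E e^{-i\mathrm{Re}\langle z,y^*\rangle}\mu(dz),$$ $$C^{\ne}_\mu(x^*,y^*)=\log\int_E e^{i\mathrm{Re}\langle z,x^*\rangle-i\mathrm{Im}\langle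 z,y^*\rangle}\mu(dz)-\log\int_E e^{i\mathrm{Re}\langle z,x^*\rangle}\mu(dz)-\log\int_E e^{-i\mathrm{Im}\langle z,y^*\rangle}\mu(dz).$$ Then: 1. $T$ leaves $\mu$ invariant. 2. For every $n\ge0$ the sum $\sum_l k_l^{p/2}k_{l+n}^{p/2}$ is finite, and for both $C_\mu=C_\mu^=$ and $C_\mu=C_\mu^{\ne}$, $$\sup_{x^*,y^*\in E^*\setminus\{0\}}\frac{|C_\mu(x^*,T^{*n}y^*)|}{\|x^*\|^{p/2}\|y^*\|^{p/2}}\le 2^{5-p}\big(a_-\lambda_-^{\alpha-p}+a_+\lambda_+^{\alpha-p}\big)\Gamma(p-\alpha)\sum_{l=0}^\infty k_l^{p/2}k_{l+n}^{p/2}.$$ 3. If $\lim_{n\to\infty}\sum_{l=0}^\infty k_l^{p/2}k_{l+n}^{p/2}=0$, then $T$ is (strongly) mixing with respect to $\mu$: $T$ preserves $\mu$ and $\mu(A\cap T^{-n}(B))\to\mu(A)\mu(B)$ for all Borel sets $A,B\subset E$. -/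

import Mathlib

open MeasureTheory ProbabilityTheory Filter Topology
open scoped ENNReal

/-! ### Strong mixing -/

/-- `T` preserves `μ` and is strongly mixing: `μ (A ∩ T⁻ⁿ B) → μ A * μ B` for all measurable `A`
and `B`. -/
def IsStronglyMixing {E : Type*} [MeasurableSpace E] (T : E → E) (μ : Measure E) : Prop :=
  MeasurePreserving T μ μ ∧
    ∀ A B : Set E, MeasurableSet A → MeasurableSet B →
      Tendsto (fun n : ℕ => μ (A ∩ T^[n] ⁻¹' B)) atTop (𝓝 (μ A * μ B))

/-! ### Logarithms of characteristic functions and codifferences -/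

/-- `L` is the continuous branch of `log ∘ φ` on the real line that vanishes at `0`
(so that necessarily `φ 0 = 1` and `φ` has no zeros). -/
def IsLogBranch (φ L : ℝ → ℂ) : Prop :=
  Continuous L ∧ L 0 = 0 ∧ ∀ t, Complex.exp (L t) = φ t

/-- The continuous branch vanishing at `0` is unique. -/
theorem IsLogBranch.unique {φ L M : ℝ → ℂ} (hL : IsLogBranch φ L) (hM : IsLogBranch φ M) :
    L = M := by
  obtain ⟨hLc, hL0, hLe⟩ := hL
  obtain ⟨hMc, hM0, hMe⟩ := hM
  have key := Complex.isCoveringMap_exp.eq_of_comp_eq (g₁ := L) (g₂ := M) hLc hMc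
    (by
      funext t
      apply Subtype.ext
      simp [hLe, hMe]) 0 (by rw [hL0, hM0])
  exact key

/-- The characteristic function `t ↦ ∫ exp (i t f) dμ` of the real function `f` under `μ`. -/
noncomputable def charPath {E : Type*} [MeasurableSpace E] (μ : Measure E) (f : E → ℝ) (t : ℝ) :
    ℂ :=
  ∫ z, Complex.exp (Complex.I * ((t * f z : ℝ) : ℂ)) ∂μ

open Classical in
/-- `log ∫ exp (i f) dμ`, where `log` is the distinguished logarithm used for infinitely divisible
laws: the value at `t = 1` of the continuous branch of `t ↦ log ∫ exp (i t f) dμ` vanishing at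
`t = 0`. (By convention it is `0` when no such branch exists, that is, when the characteristic
function has a zero.) -/
noncomputable def logChar {E : Type*} [MeasurableSpace E] (μ : Measure E) (f : E → ℝ) : ℂ :=
  if h : ∃ L, IsLogBranch (charPath μ f) L then h.choose 1 else 0

/-- Any continuous branch computes `logChar`. -/
theorem IsLogBranch.logChar_eq {E : Type*} [MeasurableSpace E] {μ : Measure E} {f : E → ℝ}
    {L : ℝ → ℂ} (hL : IsLogBranch (charPath μ f) L) : logChar μ f = L 1 := by
  have h : ∃ L, IsLogBranch (charPath μ f) L := ⟨L, hL⟩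
  rw [logChar, dif_pos h, h.choose_spec.unique hL]

section Codifference

variable {E : Type*} [NormedAddCommGroup E] [NormedSpace ℂ E] [MeasurableSpace E]

/-- The codifference `C^=_μ(x*, y*)`. -/
noncomputable def codiffEq (μ : Measure E) (x y : StrongDual ℂ E) : ℂ :=
  logChar μ (fun z => ((x - y) z).re) - logChar μ (fun z => (x z).re)
    - logChar μ (fun z => -(y z).re)

/-- The codifference `C^≠_μ(x*, y*)`. -/
noncomputable def codiffNe (μ : Measure E) (x y : StrongDual ℂ E) : ℂ :=
  logChar μ (fun z => (x z).re - (y z).im) - logChar μ (fun z => (x z).re)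
    - logChar μ (fun z => -(y z).im)

end Codifference

/-! ### Tempered stable laws on the real line -/

/-- The truncation function `κ`. -/
noncomputable def truncation (x : ℝ) : ℝ := if |x| < 1 then 1 else 1 / |x|

/-- The density of the tempered stable Lévy measure
`aNeg e^{-lNeg |x|} |x|^{-1-α} 1_{x<0} + aPos e^{-lPos x} x^{-1-α} 1_{x>0}`. -/
noncomputable def temperedStableDensity (α aNeg aPos lNeg lPos x : ℝ) : ℝ :=
  if x < 0 then aNeg * (Real.exp (-lNeg * |x|) / |x| ^ (1 + α))
  else if 0 < x then aPos * (Real.exp (-lPos * x) / x ^ (1 + α))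
  else 0

/-- The tempered stable Lévy measure. -/
noncomputable def temperedStableLevy (α aNeg aPos lNeg lPos : ℝ) : Measure ℝ :=
  volume.withDensity fun x => ENNReal.ofReal (temperedStableDensity α aNeg aPos lNeg lPos x)

/-- `ν` is the tempered stable law with characteristic function
`exp (∫ (e^{itx} - 1 - i κ(x) t x) λ(dx))`, with `λ` the tempered stable Lévy measure. -/
def IsTemperedStable (α aNeg aPos lNeg lPos : ℝ) (ν : Measure ℝ) : Prop :=
  IsProbabilityMeasure ν ∧ ∀ t : ℝ, charFun ν t =
    Complex.exp (∫ x : ℝ, (Complex.exp (Complex.I * t * x) - 1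
      - Complex.I * truncation x * t * x) ∂(temperedStableLevy α aNeg aPos lNeg lPos))

/-! ### The sequence space, the backward shift and the random series -/

/-- The complex sequence space `ℓ^p(ℕ)`. -/
abbrev SeqSpace (p : ℝ≥0∞) : Type := lp (fun _ : ℕ => ℂ) p

/-- The canonical vector `c • e_n` of `ℓ^p(ℕ)`. -/
noncomputable abbrev seqSingle (p : ℝ≥0∞) (n : ℕ) (c : ℂ) : SeqSpace p :=
  lp.single (E := fun _ : ℕ => ℂ) p n c

/-- `k_n = k₀ ∏_{l<n} 1/ω_l`. -/
noncomputable def shiftCoeff (k₀ : ℝ) (ω : ℕ → ℝ) (n : ℕ) : ℝ :=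
  k₀ * ∏ l ∈ Finset.range n, 1 / ω l

section Shift

variable {p : ℝ≥0∞}

theorem norm_weight_mul_le {ω : ℕ → ℝ} (hpos : ∀ n, 0 < ω n) (hbdd : BddAbove (Set.range ω))
    (z : ℕ → ℂ) (n : ℕ) : ‖(ω n : ℂ) * z (n + 1)‖ ≤ ‖((⨆ m, ω m : ℝ) : ℂ) * z (n + 1)‖ := by
  have h1 : ω n ≤ ⨆ m, ω m := le_ciSup hbdd n
  have h2 : 0 ≤ ⨆ m, ω m := (hpos n).le.trans h1
  rw [norm_mul, norm_mul, Complex.norm_real, Complex.norm_real, Real.norm_of_nonneg (hpos n).le,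
    Real.norm_of_nonneg h2]
  gcongr

theorem memℓp_tail {z : ℕ → ℂ} (hp1 : 1 ≤ p) (hz : Memℓp z p) :
    Memℓp (fun n => z (n + 1)) p := by
  rcases eq_or_ne p ∞ with rfl | hp
  · rw [memℓp_infty_iff] at hz ⊢
    exact hz.mono (by rintro _ ⟨n, rfl⟩; exact ⟨n + 1, rfl⟩)
  · have h0 : 0 < p.toReal := ENNReal.toReal_pos (by positivity) hp
    rw [memℓp_gen_iff h0] at hz ⊢
    exact (summable_nat_add_iff (f := fun n => ‖z n‖ ^ p.toReal) 1).2 hz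

/-- The tail map `(z_n) ↦ (z_{n+1})` on `ℓ^p(ℕ)`. -/
noncomputable def tailSeq [Fact (1 ≤ p)] (z : SeqSpace p) : SeqSpace p :=
  ⟨fun n => z (n + 1), memℓp_tail Fact.out (lp.memℓp z)⟩

theorem norm_tailSeq_le [Fact (1 ≤ p)] (z : SeqSpace p) : ‖tailSeq z‖ ≤ ‖z‖ := by
  rcases eq_or_ne p ∞ with rfl | hp
  · exact lp.norm_le_of_forall_le (norm_nonneg _)
      fun n => lp.norm_apply_le_norm (by simp) z (n + 1)
  · have h1 : 1 ≤ p := Fact.out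
    have h0 : 0 < p.toReal := ENNReal.toReal_pos (by positivity) hp
    refine lp.norm_le_of_tsum_le h0 (norm_nonneg _) ?_
    have hs : Summable fun n => ‖z n‖ ^ p.toReal := (memℓp_gen_iff h0).1 (lp.memℓp z)
    rw [lp.norm_rpow_eq_tsum h0, hs.tsum_eq_zero_add]
    exact le_add_of_nonneg_left (by positivity)

/-- The weighted backward shift on `ℓ^p(ℕ)` with bounded positive weights `ω`, as a bounded
operator: `(T z)_n = ω_n z_{n+1}`. -/
noncomputable def backwardShift (p : ℝ≥0∞) [Fact (1 ≤ p)] (ω : ℕ → ℝ) (hpos : ∀ n, 0 < ω n)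
    (hbdd : BddAbove (Set.range ω)) : SeqSpace p →L[ℂ] SeqSpace p :=
  LinearMap.mkContinuous
    { toFun := fun z => ⟨fun n => (ω n : ℂ) * z (n + 1),
        ((lp.memℓp (tailSeq z)).const_mul ((⨆ m, ω m : ℝ) : ℂ)).mono'
          fun n => norm_weight_mul_le hpos hbdd z n⟩
      map_add' := fun x y => by
        ext n
        change (ω n : ℂ) * (x (n + 1) + y (n + 1)) = ω n * x (n + 1) + ω n * y (n + 1)
        ring
      map_smul' := fun c x => by
        ext n
        change (ω n : ℂ) * (c * x (n + 1)) = c * (ω n * x (n + 1))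
        ring }
    (⨆ m, ω m)
    (fun z => by
      have h2 : 0 ≤ ⨆ m, ω m := (hpos 0).le.trans (le_ciSup hbdd 0)
      refine (lp.norm_mono (y := ((⨆ m, ω m : ℝ) : ℂ) • tailSeq z) ?_ ?_).trans ?_
      · exact (zero_lt_one.trans_le (Fact.out : 1 ≤ p)).ne'
      · exact fun n => norm_weight_mul_le hpos hbdd z n
      · rw [norm_smul, Complex.norm_real, Real.norm_of_nonneg h2]
        gcongr
        exact norm_tailSeq_le z)

theorem backwardShift_apply [Fact (1 ≤ p)] (ω : ℕ → ℝ) (hpos : ∀ n, 0 < ω n)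
    (hbdd : BddAbove (Set.range ω)) (z : SeqSpace p) (n : ℕ) :
    backwardShift p ω hpos hbdd z n = (ω n : ℂ) * z (n + 1) := rfl

/-- `T e_0 = 0`. -/
theorem backwardShift_single_zero [Fact (1 ≤ p)] (ω : ℕ → ℝ) (hpos : ∀ n, 0 < ω n)
    (hbdd : BddAbove (Set.range ω)) :
    backwardShift p ω hpos hbdd (seqSingle p 0 1) = 0 := by
  ext n
  simp [backwardShift_apply, lp.single_apply]

/-- `T e_{n+1} = ω_n e_n`. -/
theorem backwardShift_single_succ [Fact (1 ≤ p)] (ω : ℕ → ℝ) (hpos : ∀ n, 0 < ω n)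
    (hbdd : BddAbove (Set.range ω)) (n : ℕ) :
    backwardShift p ω hpos hbdd (seqSingle p (n + 1) 1) = (ω n : ℂ) • seqSingle p n 1 := by
  ext m
  rcases eq_or_ne m n with rfl | h
  · change (ω m : ℂ) * seqSingle p (m + 1) 1 (m + 1) = ω m * seqSingle p m 1 m
    simp
  · change (ω m : ℂ) * seqSingle p (n + 1) 1 (m + 1) = ω n * seqSingle p n 1 m
    simp [lp.single_apply, h]

end Shift

/-- The `n`-th term `k_n (θ_{1,n} + i θ_{2,n}) e_n` of the random series. -/
noncomputable def seriesTerm (p : ℝ≥0∞) {Ω : Type*} (k : ℕ → ℝ) (θ : Fin 2 → ℕ → Ω → ℝ) (s : Ω)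
    (n : ℕ) : SeqSpace p :=
  seqSingle p n ((k n : ℂ) * ((θ 0 n s : ℂ) + Complex.I * (θ 1 n s : ℂ)))

/-- The random series `∑ k_n (θ_{1,n} + i θ_{2,n}) e_n`, with its sum taken in `ℓ^p(ℕ)`. -/
noncomputable def randomSeries (p : ℝ≥0∞) [Fact (1 ≤ p)] {Ω : Type*} (k : ℕ → ℝ)
    (θ : Fin 2 → ℕ → Ω → ℝ) (s : Ω) : SeqSpace p :=
  ∑' n, seriesTerm p k θ s n

/-!
The random series is a measurable image `X = π ∘ θ` of the i.i.d. array `θ`, and since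
`k (n + 1) * ω n = k n`, the backward shift satisfies `T ∘ π = π ∘ σ`, where `σ` is the shift of the
columns of the array. Hence `T` is a factor of a Bernoulli shift, which makes `μ` invariant and
mixing. The series converges absolutely because `E|θ| < ∞`. This is read off the characteristic
function: `1 - cos` of the symmetrized variable is dominated by the real part of the Lévy exponent,
and integrating against `dt / t²` turns `1 - cos (t x)` into a multiple of `|x|` on both sides.
Finally the log-characteristic function of a functional of `X` is a sum of Lévy exponents, so that a
codifference is a sum of terms `∫ (e^{icx} - 1) (e^{-idx} - 1) dΛ(x)`. These are bounded using
`|e^{iu} - 1| ≤ 2 ^ (1 - s) * |u| ^ s` for `s = r / 2 ∈ [0, 1]`.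
-/

/-! ### Mixing of factors and of Bernoulli shifts -/

section Mixing

theorem IsStronglyMixing.map_of_ae_semiconj {α E : Type*} [MeasurableSpace α] [MeasurableSpace E]
    {ν : Measure α} {S : α → α} {T : E → E} {π : α → E} (hS : IsStronglyMixing S ν)
    (hT : Measurable T) (hπ : AEMeasurable π ν) (h : π ∘ S =ᵐ[ν] T ∘ π) :
    IsStronglyMixing T (ν.map π) := by
  obtain ⟨⟨hSm, hSν⟩, hmix⟩ := hS
  obtain ⟨π', hπ', hππ'⟩ := hπ
  have hqS : Measure.QuasiMeasurePreserving S ν ν := ⟨hSm, hSν.absolutelyContinuous⟩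
  have h' : π' ∘ S =ᵐ[ν] T ∘ π' :=
    (hqS.ae_eq_comp hππ'.symm).trans (h.trans (hππ'.fun_comp T))
  have hiter : ∀ n, π' ∘ S^[n] =ᵐ[ν] T^[n] ∘ π' := by
    intro n
    induction n with
    | zero => rfl
    | succ n ih =>
      rw [Function.iterate_succ, Function.iterate_succ]
      exact (hqS.ae_eq_comp ih).trans (h'.fun_comp T^[n])
  rw [Measure.map_congr hππ']
  refine ⟨⟨hT, ?_⟩, fun A B hA hB => ?_⟩
  · rw [Measure.map_map hT hπ', ← Measure.map_congr h', ← Measure.map_map hπ' hSm, hSν]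
  · rw [Measure.map_apply hπ' hA, Measure.map_apply hπ' hB]
    refine (hmix _ _ (hπ' hA) (hπ' hB)).congr fun n => ?_
    rw [Measure.map_apply hπ' (hA.inter (hT.iterate n hB))]
    refine measure_congr (EventuallyEq.rfl.inter ?_)
    filter_upwards [hiter n] with x hx
    exact congrArg (· ∈ B) hx

theorem hasSum_measureReal_iUnion {Ω : Type*} [MeasurableSpace Ω] {P : Measure Ω}
    [IsFiniteMeasure P] {A : ℕ → Set Ω} (hd : Pairwise (Function.onFun Disjoint A))
    (hA : ∀ i, MeasurableSet (A i)) : HasSum (fun i => P.real (A i)) (P.real (⋃ i, A i)) := by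
  have htop : ∑' i, P (A i) ≠ ∞ := measure_iUnion hd hA ▸ measure_ne_top P _
  simpa only [measureReal_def, measure_iUnion hd hA,
    ENNReal.tsum_toReal_eq fun i => measure_ne_top P (A i)] using ENNReal.hasSum_toReal htop

section Dynkin

variable {Ω : Type*} [MeasurableSpace Ω] {P : Measure Ω} [IsProbabilityMeasure P]
  {B : ℕ → Set Ω} {β : ℝ}

theorem tendsto_measureReal_compl_inter (hβ : ∀ n, P.real (B n) = β) {A : Set Ω}
    (hA : MeasurableSet A) (h : Tendsto (fun n => P.real (A ∩ B n)) atTop (𝓝 (P.real A * β))) :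
    Tendsto (fun n => P.real (Aᶜ ∩ B n)) atTop (𝓝 (P.real Aᶜ * β)) := by
  have hdiff : ∀ n, P.real (Aᶜ ∩ B n) = β - P.real (A ∩ B n) := fun n => by
    rw [← hβ n, ← measureReal_inter_add_sdiff (s := B n) hA, Set.inter_comm (B n) A,
      add_sub_cancel_left, Set.inter_comm, ← Set.sdiff_eq]
  simp_rw [hdiff, probReal_compl_eq_one_sub hA, sub_mul, one_mul]
  exact h.const_sub β

theorem tendsto_measureReal_iUnion_inter (hB : ∀ n, MeasurableSet (B n)) {A : ℕ → Set Ω}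
    (hd : Pairwise (Function.onFun Disjoint A)) (hA : ∀ i, MeasurableSet (A i))
    (h : ∀ i, Tendsto (fun n => P.real (A i ∩ B n)) atTop (𝓝 (P.real (A i) * β))) :
    Tendsto (fun n => P.real ((⋃ i, A i) ∩ B n)) atTop (𝓝 (P.real (⋃ i, A i) * β)) := by
  have hsum := hasSum_measureReal_iUnion (P := P) hd hA
  have hinter : ∀ n, P.real ((⋃ i, A i) ∩ B n) = ∑' i, P.real (A i ∩ B n) := fun n => by
    rw [Set.iUnion_inter]
    exact (hasSum_measureReal_iUnion
      (fun i j hij => (hd hij).mono Set.inter_subset_left Set.inter_subset_left)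
      fun i => (hA i).inter (hB n)).tsum_eq.symm
  simp_rw [hinter, ← hsum.tsum_eq, ← tsum_mul_right]
  refine tendsto_tsum_of_dominated_convergence hsum.summable h
    (Eventually.of_forall fun n i => ?_)
  rw [Real.norm_of_nonneg measureReal_nonneg]
  exact measureReal_mono Set.inter_subset_left

end Dynkin

theorem IsStronglyMixing.of_isPiSystem {Ω : Type*} [m : MeasurableSpace Ω] {P : Measure Ω}
    [IsProbabilityMeasure P] {T : Ω → Ω} (hT : MeasurePreserving T P P) {C : Set (Set Ω)}
    (hC : m = .generateFrom C) (hpi : IsPiSystem C)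
    (h : ∀ A ∈ C, ∀ B, MeasurableSet B →
      Tendsto (fun n : ℕ => P (A ∩ T^[n] ⁻¹' B)) atTop (𝓝 (P A * P B))) :
    IsStronglyMixing T P := by
  refine ⟨hT, fun A B hA hB => ?_⟩
  have hBn : ∀ n, MeasurableSet (T^[n] ⁻¹' B) := fun n => hT.measurable.iterate n hB
  have hβ : ∀ n, P.real (T^[n] ⁻¹' B) = P.real B := fun n =>
    (hT.iterate n).measureReal_preimage hB.nullMeasurableSet
  have toReal_iff : ∀ A : Set Ω,
      Tendsto (fun n => P.real (A ∩ T^[n] ⁻¹' B)) atTop (𝓝 (P.real A * P.real B)) ↔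
        Tendsto (fun n => P (A ∩ T^[n] ⁻¹' B)) atTop (𝓝 (P A * P B)) := fun A => by
    simpa only [ENNReal.toReal_mul] using! ENNReal.tendsto_toReal_iff
      (fun n => measure_ne_top P (A ∩ T^[n] ⁻¹' B))
      (ENNReal.mul_ne_top (measure_ne_top P A) (measure_ne_top P B))
  refine (toReal_iff A).1 (MeasurableSpace.induction_on_inter
    (C := fun A _ => Tendsto (fun n => P.real (A ∩ T^[n] ⁻¹' B)) atTop
      (𝓝 (P.real A * P.real B)))
    hC hpi (by simp) (fun A hA => (toReal_iff A).2 (h A hA B hB))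
    (fun A hA ih => tendsto_measureReal_compl_inter hβ hA ih)
    (fun A hd hA ih => tendsto_measureReal_iUnion_inter hBn hd hA ih) A hA)

variable {ι M : Type*} [MeasurableSpace M] {ν : Measure M} [IsProbabilityMeasure ν]

theorem comap_comp_le_iSup_comap_eval {ι M α : Type*} [MeasurableSpace M] (e : α → ι) :
    MeasurableSpace.pi.comap (fun x : ι → M => x ∘ e) ≤
      ⨆ i ∈ Set.range e, MeasurableSpace.comap (fun x : ι → M => x i) inferInstance := by
  rw [iSup_range, MeasurableSpace.pi, MeasurableSpace.comap_iSup]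
  simp only [MeasurableSpace.comap_comp]
  rfl

theorem indepFun_comp_infinitePi {α β : Type*} {f : α → ι} {g : β → ι}
    (hfg : Disjoint (Set.range f) (Set.range g)) :
    IndepFun (fun x : ι → M => x ∘ f) (fun x => x ∘ g) (Measure.infinitePi fun _ => ν) := by
  have hind : iIndepFun (fun (i : ι) (x : ι → M) => x i) (Measure.infinitePi fun _ => ν) :=
    iIndepFun_infinitePi (X := fun _ x => x) fun _ => measurable_id
  exact indep_of_indep_of_le_right (indep_of_indep_of_le_left
    (indep_iSup_of_disjoint (fun i => (measurable_pi_apply i).comap_le) hind hfg)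
    (comap_comp_le_iSup_comap_eval f)) (comap_comp_le_iSup_comap_eval g)

theorem isStronglyMixing_infinitePi_comp {τ : ι → ι} (hτ : Function.Injective τ)
    (hesc : ∀ i, ∀ᶠ n in atTop, i ∉ Set.range τ^[n]) :
    IsStronglyMixing (fun x : ι → M => x ∘ τ) (Measure.infinitePi fun _ => ν) := by
  have hpres : MeasurePreserving (fun x : ι → M => x ∘ τ) (Measure.infinitePi fun _ => ν)
      (Measure.infinitePi fun _ => ν) :=
    ⟨by fun_prop, Measure.map_infinitePi_infinitePi_of_inj hτ⟩
  refine .of_isPiSystem hpres generateFrom_measurableCylinders.symm isPiSystem_measurableCylinders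
    fun A hA B hB => ?_
  obtain ⟨s, S, hS, rfl⟩ := (mem_measurableCylinders A).1 hA
  have hiter : ∀ n, (fun x : ι → M => x ∘ τ)^[n] = fun x => x ∘ τ^[n] := by
    intro n
    induction n with
    | zero => rfl
    | succ n ih => rw [Function.iterate_succ', ih, Function.iterate_succ]; rfl
  refine tendsto_const_nhds.congr' ?_
  filter_upwards [(eventually_all_finset s).2 fun i _ => hesc i] with n hn
  have hdisj : Disjoint (Set.range ((↑) : s → ι)) (Set.range τ^[n]) := by
    rw [Subtype.range_coe_subtype]
    exact Set.disjoint_left.2 hn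
  have hind := (indepFun_comp_infinitePi (ν := ν) hdisj).measure_inter_preimage_eq_mul S B hS hB
  have hB' := (hpres.iterate n).measure_preimage hB.nullMeasurableSet
  rw [hiter] at hB' ⊢
  rw [← hB']
  exact hind.symm

end Mixing

/-! ### Lévy exponents of Lévy measures with a first moment -/

theorem truncation_nonneg (x : ℝ) : 0 ≤ _root_.truncation x := by
  unfold _root_.truncation; split_ifs <;> positivity

theorem truncation_le_one (x : ℝ) : _root_.truncation x ≤ 1 := by
  unfold _root_.truncation
  split_ifs with h
  · exact le_rfl
  · rw [div_le_one] <;> linarith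

theorem measurable_truncation : Measurable _root_.truncation := by
  unfold _root_.truncation
  exact Measurable.ite (measurableSet_lt (by fun_prop) measurable_const) measurable_const
    (by fun_prop)

/-- The Lévy–Khintchine exponent `∫ (e^{itx} - 1 - i κ(x) t x) Λ(dx)` of the Lévy measure `Λ`, for
the truncation function `κ` and with neither drift nor Gaussian part. -/
noncomputable def levyExponent (Λ : Measure ℝ) (t : ℝ) : ℂ :=
  ∫ x : ℝ, (Complex.exp (Complex.I * t * x) - 1 - Complex.I * truncation x * t * x) ∂Λ

theorem norm_exp_I_mul_sub_one_le_two (u : ℝ) : ‖Complex.exp (Complex.I * u) - 1‖ ≤ 2 := by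
  refine (norm_sub_le _ _).trans ?_
  rw [mul_comm, Complex.norm_exp_ofReal_mul_I]
  norm_num

theorem norm_levyExponent_integrand_le (t x : ℝ) :
    ‖Complex.exp (Complex.I * t * x) - 1 - Complex.I * truncation x * t * x‖
      ≤ 2 * |t| * |x| := by
  have h1 := Real.norm_exp_I_mul_ofReal_sub_one_le (x := t * x)
  have h2 : ‖Complex.I * truncation x * t * x‖ ≤ |t * x| := by
    simp only [norm_mul, Complex.norm_I, Complex.norm_real, Real.norm_eq_abs, abs_mul, one_mul]
    rw [abs_of_nonneg (truncation_nonneg x), mul_assoc]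
    exact mul_le_of_le_one_left (by positivity) (truncation_le_one x)
  push_cast at h1
  rw [← mul_assoc, Real.norm_eq_abs] at h1
  refine (norm_sub_le _ _).trans ((add_le_add h1 h2).trans ?_)
  rw [abs_mul]; linarith

theorem aestronglyMeasurable_levyExponent_integrand (Λ : Measure ℝ) (t : ℝ) :
    AEStronglyMeasurable (fun x : ℝ =>
      Complex.exp (Complex.I * t * x) - 1 - Complex.I * truncation x * t * x) Λ := by
  have := measurable_truncation
  exact Measurable.aestronglyMeasurable (by fun_prop)

section LevyExponent

variable {Λ : Measure ℝ}

theorem integrable_levyExponent_integrand (hΛ : Integrable (fun x => |x|) Λ) (t : ℝ) :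
    Integrable (fun x : ℝ =>
      Complex.exp (Complex.I * t * x) - 1 - Complex.I * truncation x * t * x) Λ :=
  (hΛ.const_mul (2 * |t|)).mono' (aestronglyMeasurable_levyExponent_integrand Λ t)
    (ae_of_all _ (norm_levyExponent_integrand_le t))

theorem norm_levyExponent_le (hΛ : Integrable (fun x => |x|) Λ) (t : ℝ) :
    ‖levyExponent Λ t‖ ≤ 2 * (∫ x, |x| ∂Λ) * |t| := by
  refine (norm_integral_le_of_norm_le (hΛ.const_mul (2 * |t|))
    (ae_of_all _ (norm_levyExponent_integrand_le t))).trans_eq ?_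
  rw [integral_const_mul]; ring

theorem levyExponent_zero (Λ : Measure ℝ) : levyExponent Λ 0 = 0 := by
  simp [levyExponent]

theorem continuous_levyExponent (hΛ : Integrable (fun x => |x|) Λ) :
    Continuous (levyExponent Λ) := by
  rw [continuous_iff_continuousAt]
  intro t₀
  refine continuousAt_of_dominated (bound := fun x => 2 * (|t₀| + 1) * |x|)
    (Eventually.of_forall fun t => aestronglyMeasurable_levyExponent_integrand Λ t) ?_
    (hΛ.const_mul _) (ae_of_all _ fun x => by fun_prop)
  filter_upwards [Metric.ball_mem_nhds t₀ one_pos] with t ht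
  refine ae_of_all _ fun x => (norm_levyExponent_integrand_le t x).trans ?_
  have : |t| ≤ |t₀| + 1 := by
    rw [Metric.mem_ball, Real.dist_eq] at ht
    have := abs_sub_abs_le_abs_sub t t₀
    linarith
  gcongr

theorem levyExponent_codifference (hΛ : Integrable (fun x => |x|) Λ) (c d : ℝ) :
    levyExponent Λ (c - d) - levyExponent Λ c - levyExponent Λ (-d) =
      ∫ x : ℝ, (Complex.exp (Complex.I * (c * x : ℝ)) - 1) *
        (Complex.exp (Complex.I * (-d * x : ℝ)) - 1) ∂Λ := by
  have h := integrable_levyExponent_integrand hΛ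
  unfold levyExponent
  rw [← integral_sub (h _) (h _)]
  refine (integral_sub ((h (c - d)).sub (h c)) (h (-d))).symm.trans ?_
  simp only [Pi.sub_apply]
  congr 1 with x
  have e : Complex.exp (Complex.I * (c - d : ℝ) * x) =
      Complex.exp (Complex.I * (c * x : ℝ)) * Complex.exp (Complex.I * (-d * x : ℝ)) := by
    rw [← Complex.exp_add]; push_cast; ring_nf
  have e1 : Complex.I * (c : ℂ) * x = Complex.I * (c * x : ℝ) := by push_cast; ring
  have e2 : Complex.I * ((-d : ℝ) : ℂ) * x = Complex.I * (-d * x : ℝ) := by push_cast; ring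
  rw [e, e1, e2]
  push_cast
  ring

theorem norm_exp_I_mul_sub_one_le_rpow (u : ℝ) {s : ℝ} (hs0 : 0 ≤ s) (hs1 : s ≤ 1) :
    ‖Complex.exp (Complex.I * u) - 1‖ ≤ 2 ^ (1 - s) * |u| ^ s := by
  set a := ‖Complex.exp (Complex.I * u) - 1‖
  have h0 : 0 ≤ a := norm_nonneg _
  calc a = a ^ (1 - s) * a ^ s := by
        rw [← Real.rpow_add_of_nonneg h0 (by linarith) hs0]; simp
    _ ≤ 2 ^ (1 - s) * |u| ^ s :=
        mul_le_mul
          (Real.rpow_le_rpow h0 (norm_exp_I_mul_sub_one_le_two u) (by linarith))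
          (Real.rpow_le_rpow h0 Real.norm_exp_I_mul_ofReal_sub_one_le hs0) (by positivity)
          (by positivity)

theorem norm_exp_sub_one_mul_exp_sub_one_le {r : ℝ} (hr0 : 0 ≤ r) (hr2 : r ≤ 2) (u v : ℝ) :
    ‖(Complex.exp (Complex.I * u) - 1) * (Complex.exp (Complex.I * v) - 1)‖ ≤
      2 ^ (2 - r) * (|u| ^ (r / 2) * |v| ^ (r / 2)) := by
  have h2 : (2 : ℝ) ^ (2 - r) = 2 ^ (1 - r / 2) * 2 ^ (1 - r / 2) := by
    rw [← Real.rpow_add two_pos]; ring_nf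
  rw [norm_mul, h2, mul_mul_mul_comm]
  gcongr <;> exact norm_exp_I_mul_sub_one_le_rpow _ (by linarith) (by linarith)

theorem norm_levyExponent_codifference_le (hΛ : Integrable (fun x => |x|) Λ) {r : ℝ}
    (hr0 : 0 ≤ r) (hr2 : r ≤ 2) (hΛr : Integrable (fun x => |x| ^ r) Λ) (c d : ℝ) :
    ‖levyExponent Λ (c - d) - levyExponent Λ c - levyExponent Λ (-d)‖ ≤
      2 ^ (2 - r) * (∫ x, |x| ^ r ∂Λ) * (|c| ^ (r / 2) * |d| ^ (r / 2)) := by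
  rw [levyExponent_codifference hΛ, mul_right_comm, ← integral_const_mul]
  refine norm_integral_le_of_norm_le (hΛr.const_mul _) (ae_of_all _ fun x => ?_)
  have hsplit : |x| ^ r = |x| ^ (r / 2) * |x| ^ (r / 2) := by
    rw [← Real.rpow_add_of_nonneg (abs_nonneg x) (by linarith) (by linarith), add_halves]
  refine (norm_exp_sub_one_mul_exp_sub_one_le hr0 hr2 (c * x) (-d * x)).trans_eq ?_
  rw [abs_mul, abs_mul, abs_neg, Real.mul_rpow (abs_nonneg c) (abs_nonneg x),
    Real.mul_rpow (abs_nonneg d) (abs_nonneg x), hsplit]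
  ring

end LevyExponent

/-! ### Integrability from the characteristic function -/

section FirstMoment

theorem one_sub_cos_nonneg (u : ℝ) : 0 ≤ 1 - Real.cos u := sub_nonneg.2 (Real.cos_le_one u)

theorem one_sub_cos_div_sq_le (u : ℝ) : (1 - Real.cos u) / u ^ 2 ≤ 4 * (1 + u ^ 2)⁻¹ := by
  rcases eq_or_ne u 0 with rfl | hu
  · simp
  rw [← div_eq_mul_inv, div_le_div_iff₀ (by positivity) (by positivity)]
  nlinarith [Real.one_sub_sq_div_two_le_cos (x := u), Real.neg_one_le_cos u, sq_nonneg u]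

theorem lintegral_one_sub_cos_div_sq_ne_top :
    ∫⁻ u : ℝ, ENNReal.ofReal ((1 - Real.cos u) / u ^ 2) ≠ ∞ :=
  ((lintegral_mono fun u => ENNReal.ofReal_le_ofReal (one_sub_cos_div_sq_le u)).trans_lt
    (integrable_inv_one_add_sq.const_mul 4).lintegral_lt_top).ne

theorem lintegral_one_sub_cos_div_sq_ne_zero :
    ∫⁻ u : ℝ, ENNReal.ofReal ((1 - Real.cos u) / u ^ 2) ≠ 0 := by
  refine ((lintegral_pos_iff_support (by fun_prop)).2 ?_).ne'
  refine (show 0 < volume (Set.Ioo (0 : ℝ) 1) by simp).trans_le (measure_mono fun u hu => ?_)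
  have hcos : Real.cos u < Real.cos 0 :=
    Real.cos_lt_cos_of_nonneg_of_le_pi le_rfl (hu.2.le.trans (by linarith [Real.pi_gt_three])) hu.1
  rw [Real.cos_zero, ← sub_pos] at hcos
  exact (ENNReal.ofReal_pos.2 (div_pos hcos (pow_pos hu.1 2))).ne'

theorem lintegral_one_sub_cos_mul_div_sq (x : ℝ) :
    ∫⁻ t : ℝ, ENNReal.ofReal ((1 - Real.cos (x * t)) / t ^ 2) =
      ‖x‖ₑ * ∫⁻ u : ℝ, ENNReal.ofReal ((1 - Real.cos u) / u ^ 2) := by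
  rcases eq_or_ne x 0 with rfl | hx
  · simp
  have hscale : ∀ t : ℝ, ENNReal.ofReal ((1 - Real.cos (x * t)) / t ^ 2) =
      ‖x‖ₑ * (‖x‖ₑ * ENNReal.ofReal ((1 - Real.cos (x * t)) / (x * t) ^ 2)) := fun t => by
    rw [Real.enorm_eq_ofReal_abs, ← ENNReal.ofReal_mul (abs_nonneg x),
      ← ENNReal.ofReal_mul (abs_nonneg x), ← mul_assoc, abs_mul_abs_self, ← sq]
    congr 1
    field_simp
  have hvol : ∫⁻ u : ℝ, ENNReal.ofReal ((1 - Real.cos u) / u ^ 2) =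
      ‖x‖ₑ * ∫⁻ t : ℝ, ENNReal.ofReal ((1 - Real.cos (x * t)) / (x * t) ^ 2) := by
    conv_lhs => rw [← Real.smul_map_volume_mul_left hx]
    rw [lintegral_smul_measure, lintegral_map (by fun_prop) (by fun_prop),
      Real.enorm_eq_ofReal_abs, smul_eq_mul]
  simp_rw [hscale]
  rw [lintegral_const_mul _ (by fun_prop), lintegral_const_mul _ (by fun_prop), hvol]

theorem lintegral_lintegral_one_sub_cos_div_sq (m : Measure ℝ) [SFinite m] :
    ∫⁻ t : ℝ, ENNReal.ofReal (1 / t ^ 2) * ∫⁻ x, ENNReal.ofReal (1 - Real.cos (x * t)) ∂m =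
      (∫⁻ x, ‖x‖ₑ ∂m) * ∫⁻ u : ℝ, ENNReal.ofReal ((1 - Real.cos u) / u ^ 2) := by
  have hmul : ∀ t x : ℝ, ENNReal.ofReal (1 / t ^ 2) * ENNReal.ofReal (1 - Real.cos (x * t)) =
      ENNReal.ofReal ((1 - Real.cos (x * t)) / t ^ 2) := fun t x => by
    rw [← ENNReal.ofReal_mul (by positivity), one_div_mul_eq_div]
  have hmeas : ∀ t : ℝ, Measurable fun x : ℝ => ENNReal.ofReal (1 - Real.cos (x * t)) :=
    fun t => by fun_prop
  simp_rw [← lintegral_const_mul _ (hmeas _), hmul]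
  rw [lintegral_lintegral_swap (Measurable.aemeasurable (by fun_prop))]
  simp_rw [lintegral_one_sub_cos_mul_div_sq]
  exact lintegral_mul_const _ (by fun_prop)

theorem lintegral_enorm_le_of_lintegral_one_sub_cos_le {m₁ m₂ : Measure ℝ} [SFinite m₁]
    [SFinite m₂] {C : ℝ≥0∞} (h : ∀ t, ∫⁻ x, ENNReal.ofReal (1 - Real.cos (x * t)) ∂m₁ ≤
      C * ∫⁻ x, ENNReal.ofReal (1 - Real.cos (x * t)) ∂m₂) :
    ∫⁻ x, ‖x‖ₑ ∂m₁ ≤ C * ∫⁻ x, ‖x‖ₑ ∂m₂ := by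
  rw [← ENNReal.mul_le_mul_iff_left lintegral_one_sub_cos_div_sq_ne_zero
    lintegral_one_sub_cos_div_sq_ne_top, mul_assoc, ← lintegral_lintegral_one_sub_cos_div_sq m₁,
    ← lintegral_lintegral_one_sub_cos_div_sq m₂]
  refine (lintegral_mono fun t => mul_le_mul_right (h t) _).trans_eq ?_
  simp_rw [mul_left_comm _ C]
  refine lintegral_const_mul C ?_
  have : Measurable fun q : ℝ × ℝ => ENNReal.ofReal (1 - Real.cos (q.2 * q.1)) := by fun_prop
  exact Measurable.mul (by fun_prop) this.lintegral_prod_right'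

theorem re_levyExponent_integrand (t x : ℝ) :
    (Complex.exp (Complex.I * t * x) - 1 - Complex.I * _root_.truncation x * t * x).re =
      -(1 - Real.cos (x * t)) := by
  have hexp : Complex.I * t * x = (x * t : ℝ) * Complex.I := by push_cast; ring
  have htrunc : Complex.I * _root_.truncation x * t * x =
      (_root_.truncation x * t * x : ℝ) * Complex.I := by push_cast; ring
  rw [hexp, htrunc]
  simp [Complex.exp_ofReal_mul_I_re, -Complex.ofReal_mul]

theorem integrable_one_sub_cos_mul {Λ : Measure ℝ} (hΛ : Integrable (fun x => |x|) Λ) (t : ℝ) :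
    Integrable (fun x => 1 - Real.cos (x * t)) Λ := by
  refine (integrable_levyExponent_integrand hΛ t).re.neg.congr (ae_of_all _ fun x => ?_)
  exact (congrArg Neg.neg (re_levyExponent_integrand t x)).trans (neg_neg _)

theorem re_levyExponent {Λ : Measure ℝ} (hΛ : Integrable (fun x => |x|) Λ) (t : ℝ) :
    (levyExponent Λ t).re = -∫ x, (1 - Real.cos (x * t)) ∂Λ := by
  rw [levyExponent, ← integral_neg]
  exact (integral_re (integrable_levyExponent_integrand hΛ t)).symm.trans
    (integral_congr_ae (ae_of_all _ fun x => re_levyExponent_integrand t x))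

theorem lintegral_one_sub_cos_eq_one_sub_re_charFun (m : Measure ℝ) [IsProbabilityMeasure m]
    (t : ℝ) : ∫⁻ x, ENNReal.ofReal (1 - Real.cos (x * t)) ∂m =
      ENNReal.ofReal (1 - (charFun m t).re) := by
  have hexp : Integrable (fun x : ℝ => Complex.exp ((x * t : ℝ) * Complex.I)) m :=
    .of_bound (by fun_prop) 1 (ae_of_all _ fun x => (Complex.norm_exp_ofReal_mul_I _).le)
  have hre : (charFun m t).re = ∫ x, Real.cos (x * t) ∂m := by
    simp_rw [← Complex.exp_ofReal_mul_I_re]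
    refine Eq.trans ?_ (integral_re hexp).symm
    rw [charFun_apply_real]
    congr! 4
    push_cast
    ring
  have hcos : Integrable (fun x => Real.cos (x * t)) m :=
    .of_bound (by fun_prop) 1 (ae_of_all _ fun x => Real.abs_cos_le_one _)
  refine (ofReal_integral_eq_lintegral_ofReal ((integrable_const 1).sub hcos)
    (ae_of_all _ fun x => one_sub_cos_nonneg _)).symm.trans (congrArg ENNReal.ofReal ?_)
  rw [hre]
  simpa using! integral_sub (integrable_const 1) hcos

theorem charFun_conv_map_neg (m : Measure ℝ) [IsFiniteMeasure m] (t : ℝ) :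
    charFun (m ∗ m.map (fun x => -x)) t = (‖charFun m t‖ ^ 2 : ℝ) := by
  have hneg : charFun (m.map (fun x => -x)) t = charFun m (-t) := by
    simpa using charFun_map_mul (μ := m) (-1) t
  rw [charFun_conv, hneg, charFun_neg, Complex.mul_conj, Complex.normSq_eq_norm_sq]

theorem integrable_id_of_integrable_id_conv {m₁ m₂ : Measure ℝ} [IsProbabilityMeasure m₁]
    [IsFiniteMeasure m₂] (h : Integrable (fun x => x) (m₁ ∗ m₂)) :
    Integrable (fun x => x) m₂ := by
  obtain ⟨x, hx⟩ := ((integrable_conv_iff (by fun_prop)).1 h).1.exists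
  exact (hx.sub (integrable_const x)).congr (ae_of_all _ fun y => add_sub_cancel_left x y)

theorem integrable_id_of_charFun_eq_exp_levyExponent {Λ ν : Measure ℝ} [SFinite Λ]
    [IsProbabilityMeasure ν] (hΛ : Integrable (fun x => |x|) Λ)
    (hchar : ∀ t, charFun ν t = Complex.exp (levyExponent Λ t)) :
    Integrable (fun x => x) ν := by
  have hprob : IsProbabilityMeasure (ν.map fun x => -x) :=
    Measure.isProbabilityMeasure_map (by fun_prop)
  have hdom : ∀ t, ∫⁻ x, ENNReal.ofReal (1 - Real.cos (x * t)) ∂(ν.map (fun x => -x) ∗ ν) ≤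
      2 * ∫⁻ x, ENNReal.ofReal (1 - Real.cos (x * t)) ∂Λ := fun t => by
    rw [lintegral_one_sub_cos_eq_one_sub_re_charFun, Measure.conv_comm, charFun_conv_map_neg,
      hchar, Complex.norm_exp, re_levyExponent hΛ,
      ← ofReal_integral_eq_lintegral_ofReal (integrable_one_sub_cos_mul hΛ t)
        (ae_of_all _ fun x => one_sub_cos_nonneg _), ← ENNReal.ofReal_ofNat,
      ← ENNReal.ofReal_mul zero_le_two, Complex.ofReal_re, ← Real.exp_nat_mul]
    refine ENNReal.ofReal_le_ofReal ?_
    push_cast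
    linarith [Real.add_one_le_exp (2 * -∫ x, (1 - Real.cos (x * t)) ∂Λ)]
  refine integrable_id_of_integrable_id_conv (m₁ := ν.map fun x => -x) ⟨by fun_prop, ?_⟩
  refine (lintegral_enorm_le_of_lintegral_one_sub_cos_le hdom).trans_lt ?_
  exact ENNReal.mul_lt_top ENNReal.ofNat_lt_top (by simpa [HasFiniteIntegral] using hΛ.2)

end FirstMoment

/-! ### Moments of the tempered stable Lévy measure -/

section Moments

variable {α aNeg aPos lNeg lPos q : ℝ}

theorem temperedStableDensity_nonneg (haNeg : 0 ≤ aNeg) (haPos : 0 ≤ aPos) (x : ℝ) :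
    0 ≤ temperedStableDensity α aNeg aPos lNeg lPos x := by
  unfold temperedStableDensity
  split_ifs <;> positivity

theorem measurable_temperedStableDensity :
    Measurable (temperedStableDensity α aNeg aPos lNeg lPos) := by
  unfold temperedStableDensity
  exact Measurable.ite measurableSet_Iio (by fun_prop)
    (Measurable.ite measurableSet_Ioi (by fun_prop) measurable_const)

theorem temperedStableDensity_neg (x : ℝ) :
    temperedStableDensity α aNeg aPos lNeg lPos (-x) =
      temperedStableDensity α aPos aNeg lPos lNeg x := by
  unfold temperedStableDensity
  rcases lt_trichotomy x 0 with hx | rfl | hx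
  · simp [hx, hx.not_gt, abs_of_neg hx]
  · simp
  · simp [hx, hx.not_gt, abs_of_pos hx]

theorem temperedStableDensity_mul_abs_rpow_of_pos {x : ℝ} (hx : 0 < x) :
    temperedStableDensity α aNeg aPos lNeg lPos x * |x| ^ q =
      aPos * (x ^ (q - α - 1) * Real.exp (-(lPos * x))) := by
  rw [temperedStableDensity, if_neg hx.not_gt, if_pos hx, abs_of_pos hx,
    show q - α - 1 = q - (1 + α) by ring, Real.rpow_sub hx, neg_mul]
  ring

theorem integrableOn_Ioi_temperedStableDensity_mul_abs_rpow (hlPos : 0 < lPos) (hq : α < q) :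
    IntegrableOn (fun x => temperedStableDensity α aNeg aPos lNeg lPos x * |x| ^ q)
      (Set.Ioi 0) := by
  have hgamma : IntegrableOn (fun x : ℝ => x ^ (q - α - 1) * Real.exp (-(lPos * x)))
      (Set.Ioi 0) := by
    simpa [IntegrableOn] using integrableOn_rpow_mul_exp_neg_mul_rpow (p := 1) (s := q - α - 1)
      (b := lPos) (by linarith) one_pos hlPos
  exact IntegrableOn.congr_fun (hgamma.const_mul aPos)
    (fun x hx => (temperedStableDensity_mul_abs_rpow_of_pos hx).symm) measurableSet_Ioi

theorem integral_Ioi_temperedStableDensity_mul_abs_rpow (hlPos : 0 < lPos) (hq : α < q) :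
    ∫ x in Set.Ioi (0 : ℝ), temperedStableDensity α aNeg aPos lNeg lPos x * |x| ^ q =
      aPos * lPos ^ (α - q) * Real.Gamma (q - α) := by
  rw [setIntegral_congr_fun measurableSet_Ioi
      fun x hx => temperedStableDensity_mul_abs_rpow_of_pos hx, integral_const_mul,
    Real.integral_rpow_mul_exp_neg_mul_Ioi (by linarith) hlPos, one_div, Real.inv_rpow hlPos.le,
    ← Real.rpow_neg hlPos.le, neg_sub, mul_assoc]

theorem integrableOn_Iic_temperedStableDensity_mul_abs_rpow (hlNeg : 0 < lNeg) (hq : α < q) :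
    IntegrableOn (fun x => temperedStableDensity α aNeg aPos lNeg lPos x * |x| ^ q)
      (Set.Iic 0) := by
  rw [integrableOn_Iic_iff_integrableOn_Iio, ← (Measure.measurePreserving_neg
    volume).integrableOn_comp_preimage (Homeomorph.neg ℝ).measurableEmbedding]
  simpa [Function.comp_def, temperedStableDensity_neg] using
    integrableOn_Ioi_temperedStableDensity_mul_abs_rpow (aNeg := aPos) hlNeg hq

theorem integral_Iic_temperedStableDensity_mul_abs_rpow (hlNeg : 0 < lNeg) (hq : α < q) :
    ∫ x in Set.Iic (0 : ℝ), temperedStableDensity α aNeg aPos lNeg lPos x * |x| ^ q =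
      aNeg * lNeg ^ (α - q) * Real.Gamma (q - α) := by
  rw [← neg_zero, ← integral_comp_neg_Ioi]
  simp_rw [temperedStableDensity_neg, abs_neg]
  exact integral_Ioi_temperedStableDensity_mul_abs_rpow hlNeg hq

theorem integrable_temperedStableLevy_iff (haNeg : 0 ≤ aNeg) (haPos : 0 ≤ aPos) {f : ℝ → ℝ} :
    Integrable f (temperedStableLevy α aNeg aPos lNeg lPos) ↔
      Integrable fun x => temperedStableDensity α aNeg aPos lNeg lPos x * f x := by
  rw [temperedStableLevy, integrable_withDensity_iff_integrable_smul'
    measurable_temperedStableDensity.ennreal_ofReal (by simp)]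
  simp_rw [ENNReal.toReal_ofReal (temperedStableDensity_nonneg haNeg haPos _), smul_eq_mul]

theorem integral_temperedStableLevy (haNeg : 0 ≤ aNeg) (haPos : 0 ≤ aPos) (f : ℝ → ℝ) :
    ∫ x, f x ∂(temperedStableLevy α aNeg aPos lNeg lPos) =
      ∫ x, temperedStableDensity α aNeg aPos lNeg lPos x * f x := by
  rw [temperedStableLevy, integral_withDensity_eq_integral_toReal_smul
    measurable_temperedStableDensity.ennreal_ofReal (by simp)]
  simp_rw [ENNReal.toReal_ofReal (temperedStableDensity_nonneg haNeg haPos _), smul_eq_mul]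

theorem integrable_abs_rpow_temperedStableLevy (haNeg : 0 ≤ aNeg) (haPos : 0 ≤ aPos)
    (hlNeg : 0 < lNeg) (hlPos : 0 < lPos) (hq : α < q) :
    Integrable (fun x => |x| ^ q) (temperedStableLevy α aNeg aPos lNeg lPos) := by
  rw [integrable_temperedStableLevy_iff haNeg haPos, ← integrableOn_univ,
    ← Set.Iic_union_Ioi (a := (0 : ℝ))]
  exact (integrableOn_Iic_temperedStableDensity_mul_abs_rpow hlNeg hq).union
    (integrableOn_Ioi_temperedStableDensity_mul_abs_rpow hlPos hq)

theorem integral_abs_rpow_temperedStableLevy (haNeg : 0 ≤ aNeg) (haPos : 0 ≤ aPos)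
    (hlNeg : 0 < lNeg) (hlPos : 0 < lPos) (hq : α < q) :
    ∫ x, |x| ^ q ∂(temperedStableLevy α aNeg aPos lNeg lPos) =
      (aNeg * lNeg ^ (α - q) + aPos * lPos ^ (α - q)) * Real.Gamma (q - α) := by
  rw [integral_temperedStableLevy haNeg haPos, ← intervalIntegral.integral_Iic_add_Ioi
      (integrableOn_Iic_temperedStableDensity_mul_abs_rpow hlNeg hq)
      (integrableOn_Ioi_temperedStableDensity_mul_abs_rpow hlPos hq),
    integral_Iic_temperedStableDensity_mul_abs_rpow hlNeg hq,
    integral_Ioi_temperedStableDensity_mul_abs_rpow hlPos hq, add_mul]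

instance : SFinite (temperedStableLevy α aNeg aPos lNeg lPos) := by
  unfold temperedStableLevy; infer_instance

end Moments

/-! ### Weighted sums of independent infinitely divisible variables -/

section WeightedSum

variable {Λ : Measure ℝ} {ι : Type*}

theorem summable_levyExponent (hΛ : Integrable (fun x => |x|) Λ) {c : ι → ℝ}
    (hc : Summable fun q => |c q|) : Summable fun q => levyExponent Λ (c q) :=
  Summable.of_norm_bounded (hc.mul_left _) fun q => norm_levyExponent_le hΛ (c q)

theorem continuous_tsum_levyExponent (hΛ : Integrable (fun x => |x|) Λ) {c : ι → ℝ}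
    (hc : Summable fun q => |c q|) : Continuous fun t : ℝ => ∑' q, levyExponent Λ (t * c q) := by
  refine continuous_iff_continuousAt.2 fun t₀ => ?_
  have : 0 ≤ ∫ x, |x| ∂Λ := integral_nonneg fun x => abs_nonneg x
  have hball : ContinuousOn (fun t : ℝ => ∑' q, levyExponent Λ (t * c q)) (Metric.ball t₀ 1) := by
    refine continuousOn_tsum
      (fun q => ((continuous_levyExponent hΛ).comp (continuous_mul_const _)).continuousOn)
      ((hc.mul_left (|t₀| + 1)).mul_left (2 * ∫ x, |x| ∂Λ)) fun q t ht => ?_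
    have ht' : |t| ≤ |t₀| + 1 := by
      have := abs_sub_abs_le_abs_sub t t₀
      rw [Metric.mem_ball, Real.dist_eq] at ht
      linarith
    refine (norm_levyExponent_le hΛ _).trans ?_
    rw [abs_mul]
    gcongr
  exact hball.continuousAt (Metric.ball_mem_nhds t₀ one_pos)

variable {Ω : Type*} [MeasurableSpace Ω] {P : Measure Ω} {ξ : ι → Ω → ℝ} {c : ι → ℝ}

theorem ae_summable_abs_mul [Countable ι] {ν : Measure ℝ} (hν : Integrable (fun x => x) ν)
    (hξ : ∀ q, Measurable (ξ q)) (hlaw : ∀ q, P.map (ξ q) = ν) (hc : Summable fun q => |c q|) :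
    ∀ᵐ s ∂P, Summable fun q => |c q * ξ q s| := by
  refine summable_norm_of_tsum_eLpNorm_ne_top (f := fun q s => c q * ξ q s) le_rfl
    (fun q => ((hξ q).const_mul _).aestronglyMeasurable) ?_
  have hnorm : ∀ q, eLpNorm (fun s => c q * ξ q s) 1 P = ‖c q‖ₑ * eLpNorm (fun x => x) 1 ν :=
    fun q => by
      rw [← hlaw q, eLpNorm_map_measure measurable_id'.aestronglyMeasurable (hξ q).aemeasurable]
      exact eLpNorm_const_smul (c q) (ξ q) 1 P
  simp_rw [hnorm]
  rw [ENNReal.tsum_mul_right]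
  exact ENNReal.mul_ne_top (tsum_enorm_ne_top_iff_summable_norm.2 hc)
    (memLp_one_iff_integrable.2 hν).eLpNorm_ne_top

theorem integral_exp_finsetSum_mul (hξ : ∀ q, Measurable (ξ q)) (hindep : iIndepFun ξ P)
    (hchar : ∀ q t, charFun (P.map (ξ q)) t = Complex.exp (levyExponent Λ t)) (c : ι → ℝ)
    (S : Finset ι) :
    ∫ s, Complex.exp (Complex.I * ((∑ q ∈ S, c q * ξ q s : ℝ) : ℂ)) ∂P =
      Complex.exp (∑ q ∈ S, levyExponent Λ (c q)) := by
  have hm : ∀ q, Measurable fun s => c q * ξ q s := fun q => (hξ q).const_mul _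
  have hind : iIndepFun (fun q s => c q * ξ q s) P :=
    hindep.comp (fun q x => c q * x) fun q => measurable_const_mul _
  have h := congrFun ((hind.restrict S).charFun_map_fun_finsetSum_eq_prod
    (s := S) fun q _ => (hm q).aemeasurable) 1
  rw [charFun_apply_real, Finset.prod_apply, integral_map
    (Finset.measurable_fun_sum _ fun q _ => hm q).aemeasurable (by fun_prop)] at h
  rw [Complex.exp_sum]
  convert h using 2 with s
  · push_cast; ring_nf
  · rw [charFun_map_mul_comp (hξ _).aemeasurable, mul_one, hchar]

theorem integral_exp_weightedSum [Countable ι] [IsProbabilityMeasure P]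
    (hΛ : Integrable (fun x => |x|) Λ) (hξ : ∀ q, Measurable (ξ q)) (hindep : iIndepFun ξ P)
    (hchar : ∀ q t, charFun (P.map (ξ q)) t = Complex.exp (levyExponent Λ t))
    (hc : Summable fun q => |c q|) {Y : Ω → ℝ} (hY : ∀ᵐ s ∂P, HasSum (fun q => c q * ξ q s) (Y s)) :
    ∫ s, Complex.exp (Complex.I * (Y s : ℂ)) ∂P =
      Complex.exp (∑' q, levyExponent Λ (c q)) := by
  have hlim : Tendsto (fun S : Finset ι =>
      ∫ s, Complex.exp (Complex.I * ((∑ q ∈ S, c q * ξ q s : ℝ) : ℂ)) ∂P) atTop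
      (𝓝 (∫ s, Complex.exp (Complex.I * (Y s : ℂ)) ∂P)) := by
    refine tendsto_integral_filter_of_dominated_convergence (fun _ => 1)
      (Eventually.of_forall fun S => Measurable.aestronglyMeasurable (by fun_prop))
      (Eventually.of_forall fun S => ae_of_all _ fun s => ?_) (integrable_const _) ?_
    · rw [mul_comm, Complex.norm_exp_ofReal_mul_I]
    · have hcont : Continuous fun y : ℝ => Complex.exp (Complex.I * (y : ℂ)) := by fun_prop
      filter_upwards [hY] with s hs using (hcont.tendsto _).comp hs
  simp_rw [integral_exp_finsetSum_mul hξ hindep hchar c] at hlim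
  exact tendsto_nhds_unique hlim
    ((Complex.continuous_exp.tendsto _).comp (summable_levyExponent hΛ hc).hasSum)

end WeightedSum

/-! ### The random series in `ℓ^p` -/

theorem hasSum_comp_snd {ι κ : Type*} [Fintype ι] {f : κ → ℝ} {a : ℝ} (hf : HasSum f a) :
    HasSum (fun q : ι × κ => f q.2) (Fintype.card ι * a) := by
  have hs : Summable fun q : ι × κ => f q.2 :=
    Summable.of_abs <| (summable_prod_of_nonneg fun _ => abs_nonneg _).2
      ⟨fun _ => hf.summable.abs, Summable.of_finite⟩
  have htsum : ∑' q : ι × κ, f q.2 = Fintype.card ι * a := by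
    rw [hs.tsum_prod, tsum_fintype]
    simp [hf.tsum_eq]
  exact htsum ▸ hs.hasSum

/-- The canonical real basis `e_n, i e_n` of `ℓ^p(ℕ)`: the vector `i ^ j e_n` at the index
`(j, n)`. -/
noncomputable def realSingle (p : ℝ≥0∞) (q : Fin 2 × ℕ) : SeqSpace p :=
  seqSingle p q.2 (Complex.I ^ (q.1 : ℕ))

section Series

variable {p : ℝ≥0∞} {Ω : Type*} {k : ℕ → ℝ} {θ : Fin 2 → ℕ → Ω → ℝ} {s : Ω}

theorem seriesTerm_eq_sum (s : Ω) (n : ℕ) :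
    seriesTerm p k θ s n = ∑ i, (k n * θ i n s) • realSingle p (i, n) := by
  have hsmul (a : ℝ) (c : ℂ) : a • seqSingle p n c = seqSingle p n (a * c) := by
    rw [seqSingle, ← lp.single_smul, Complex.real_smul]
  simp only [seriesTerm, realSingle, Fin.sum_univ_two, hsmul, ← lp.single_add, Fin.val_zero,
    Fin.val_one, pow_zero, pow_one]
  push_cast
  ring_nf

variable [Fact (1 ≤ p)]

theorem norm_realSingle (q : Fin 2 × ℕ) : ‖realSingle p q‖ = 1 := by
  have hp : 0 < p := one_pos.trans_le Fact.out
  rw [realSingle, seqSingle, lp.norm_single hp, norm_pow, Complex.norm_I, one_pow]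

theorem hasSum_seriesTerm {z : SeqSpace p}
    (hz : HasSum (fun q : Fin 2 × ℕ => (k q.2 * θ q.1 q.2 s) • realSingle p q) z) :
    HasSum (seriesTerm p k θ s) z := by
  have hswap := ((Equiv.prodComm ℕ (Fin 2)).hasSum_iff).2 hz
  rw [funext (seriesTerm_eq_sum s)]
  exact hswap.prod_fiberwise fun n => hasSum_fintype _

theorem hasSum_randomSeries (hs : Summable fun q : Fin 2 × ℕ => |k q.2 * θ q.1 q.2 s|) :
    HasSum (fun q : Fin 2 × ℕ => (k q.2 * θ q.1 q.2 s) • realSingle p q)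
      (randomSeries p k θ s) := by
  have hsum : Summable fun q : Fin 2 × ℕ => (k q.2 * θ q.1 q.2 s) • realSingle p q :=
    Summable.of_norm (by simpa [norm_smul, norm_realSingle, abs_mul] using hs)
  rw [randomSeries, (hasSum_seriesTerm hsum.hasSum).tsum_eq]
  exact hsum.hasSum

theorem aemeasurable_randomSeries [MeasurableSpace Ω] {P : Measure Ω} [MeasurableSpace (SeqSpace p)]
    [BorelSpace (SeqSpace p)] (hθ : ∀ i n, Measurable (θ i n))
    (hs : ∀ᵐ s ∂P, Summable fun q : Fin 2 × ℕ => |k q.2 * θ q.1 q.2 s|) :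
    AEMeasurable (randomSeries p k θ) P := by
  have hterm : ∀ n, StronglyMeasurable fun s => seriesTerm p k θ s n := fun n => by
    simp only [seriesTerm_eq_sum]
    exact Finset.stronglyMeasurable_fun_sum _ fun i _ =>
      ((hθ i n).const_mul _).stronglyMeasurable.smul_const _
  refine (aestronglyMeasurable_of_tendsto_ae atTop (fun N => (Finset.stronglyMeasurable_fun_sum
    (Finset.range N) fun n _ => hterm n).aestronglyMeasurable) ?_).aemeasurable
  filter_upwards [hs] with s hs
  exact (hasSum_seriesTerm (hasSum_randomSeries hs)).tendsto_sum_nat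

/-- The coefficient of `θ i n` in `L (∑ k_n (θ_{0,n} + i θ_{1,n}) e_n)`, at the index `(i, n)`. -/
noncomputable def seriesCoeff (k : ℕ → ℝ) (L : StrongDual ℝ (SeqSpace p)) (q : Fin 2 × ℕ) : ℝ :=
  k q.2 * L (realSingle p q)

theorem abs_seriesCoeff_le (k : ℕ → ℝ) (L : StrongDual ℝ (SeqSpace p)) (q : Fin 2 × ℕ) :
    |seriesCoeff k L q| ≤ |k q.2| * ‖L‖ := by
  rw [seriesCoeff, abs_mul]
  gcongr
  simpa [norm_realSingle] using L.le_opNorm (realSingle p q)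

theorem summable_abs_seriesCoeff (hk : Summable fun n => |k n|) (L : StrongDual ℝ (SeqSpace p)) :
    Summable fun q => |seriesCoeff k L q| :=
  have hk' : Summable fun q : Fin 2 × ℕ => |k q.2| := (hasSum_comp_snd hk.hasSum).summable
  .of_nonneg_of_le (fun _ => abs_nonneg _) (abs_seriesCoeff_le k L) (hk'.mul_right ‖L‖)

theorem hasSum_apply_randomSeries (L : StrongDual ℝ (SeqSpace p))
    (hs : Summable fun q : Fin 2 × ℕ => |k q.2 * θ q.1 q.2 s|) :
    HasSum (fun q : Fin 2 × ℕ => seriesCoeff k L q * θ q.1 q.2 s) (L (randomSeries p k θ s)) := by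
  refine ((hasSum_randomSeries hs).mapL L).congr_fun fun q => ?_
  rw [map_smul, smul_eq_mul, seriesCoeff]
  ring

variable {Λ : Measure ℝ} [MeasurableSpace Ω] {P : Measure Ω} [IsProbabilityMeasure P]
  [MeasurableSpace (SeqSpace p)] [BorelSpace (SeqSpace p)]

theorem isLogBranch_randomSeries (hΛ : Integrable (fun x => |x|) Λ) (hk : Summable fun n => |k n|)
    (hθ : ∀ i n, Measurable (θ i n)) (hindep : iIndepFun (fun q : Fin 2 × ℕ => θ q.1 q.2) P)
    (hchar : ∀ i n t, charFun (P.map (θ i n)) t = Complex.exp (levyExponent Λ t))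
    (hs : ∀ᵐ s ∂P, Summable fun q : Fin 2 × ℕ => |k q.2 * θ q.1 q.2 s|)
    (L : StrongDual ℝ (SeqSpace p)) :
    IsLogBranch (charPath (P.map (randomSeries p k θ)) L)
      fun t => ∑' q, levyExponent Λ (t * seriesCoeff k L q) := by
  have hc := summable_abs_seriesCoeff hk L
  refine ⟨continuous_tsum_levyExponent hΛ hc, by simp [levyExponent_zero], fun t => ?_⟩
  rw [charPath, integral_map (aemeasurable_randomSeries hθ hs)
    (Measurable.aestronglyMeasurable (by fun_prop))]
  refine (integral_exp_weightedSum hΛ (fun q => hθ q.1 q.2) hindep (fun q => hchar q.1 q.2)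
    (by simpa [abs_mul] using hc.mul_left |t|) ?_).symm
  filter_upwards [hs] with s hs
  simpa only [mul_assoc] using (hasSum_apply_randomSeries L hs).mul_left t

end Series

/-! ### The backward shift as a factor of a Bernoulli shift -/

section Shift

theorem seqSingle_eq_smul {p : ℝ≥0∞} (n : ℕ) (c : ℂ) : seqSingle p n c = c • seqSingle p n 1 := by
  rw [seqSingle, ← lp.single_smul, smul_eq_mul, mul_one]

theorem shiftCoeff_succ_mul (k₀ : ℝ) {ω : ℕ → ℝ} {n : ℕ} (hn : ω n ≠ 0) :
    shiftCoeff k₀ ω (n + 1) * ω n = shiftCoeff k₀ ω n := by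
  rw [shiftCoeff, shiftCoeff, Finset.prod_range_succ, ← mul_assoc, one_div,
    inv_mul_cancel_right₀ hn]

theorem shiftCoeff_pos {k₀ : ℝ} (hk₀ : 0 < k₀) {ω : ℕ → ℝ} (hpos : ∀ n, 0 < ω n) (n : ℕ) :
    0 < shiftCoeff k₀ ω n :=
  mul_pos hk₀ (Finset.prod_pos fun l _ => one_div_pos.2 (hpos l))

variable {p : ℝ≥0∞} [Fact (1 ≤ p)] {k₀ : ℝ} {ω : ℕ → ℝ} (hpos : ∀ n, 0 < ω n)
  (hbdd : BddAbove (Set.range ω))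

theorem backwardShift_realSingle_zero (i : Fin 2) :
    backwardShift p ω hpos hbdd (realSingle p (i, 0)) = 0 := by
  rw [realSingle, seqSingle_eq_smul, map_smul, backwardShift_single_zero, smul_zero]

theorem backwardShift_realSingle_succ (i : Fin 2) (n : ℕ) :
    backwardShift p ω hpos hbdd (realSingle p (i, n + 1)) = ω n • realSingle p (i, n) := by
  rw [realSingle, realSingle, seqSingle_eq_smul, map_smul, backwardShift_single_succ,
    seqSingle_eq_smul n (Complex.I ^ _), smul_comm, Complex.coe_smul]
  rfl

variable {Ω : Type*} {θ : Fin 2 → ℕ → Ω → ℝ}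

theorem backwardShift_randomSeries {s : Ω}
    (hs : Summable fun q : Fin 2 × ℕ => |shiftCoeff k₀ ω q.2 * θ q.1 q.2 s|) :
    backwardShift p ω hpos hbdd (randomSeries p (shiftCoeff k₀ ω) θ s) =
      randomSeries p (shiftCoeff k₀ ω) (fun i n => θ i (n + 1)) s := by
  have hT := (hasSum_randomSeries (p := p) hs).mapL
    ((backwardShift p ω hpos hbdd).restrictScalars ℝ)
  have hinj : Function.Injective (Prod.map id Nat.succ : Fin 2 × ℕ → Fin 2 × ℕ) :=
    Function.injective_id.prodMap Nat.succ_injective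
  refine (hasSum_seriesTerm (((hinj.hasSum_iff ?_).2 hT).congr_fun fun q => ?_)).tsum_eq.symm
  · rintro ⟨i, _ | n⟩ hq
    · rw [map_smul, ContinuousLinearMap.coe_restrictScalars', backwardShift_realSingle_zero,
        smul_zero]
    · exact absurd ⟨(i, n), rfl⟩ hq
  · rw [Function.comp_apply, map_smul, ContinuousLinearMap.coe_restrictScalars', Prod.map_apply',
      backwardShift_realSingle_succ, smul_smul, mul_right_comm, shiftCoeff_succ_mul k₀ (hpos _).ne']
    rfl

theorem isStronglyMixing_randomSeries [MeasurableSpace Ω] {P : Measure Ω} [IsProbabilityMeasure P]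
    [MeasurableSpace (SeqSpace p)] [BorelSpace (SeqSpace p)]
    {ν : Measure ℝ} (hν : Integrable (fun x => x) ν)
    (hk : Summable fun n => |shiftCoeff k₀ ω n|)
    (hθ : ∀ i n, Measurable (θ i n)) (hindep : iIndepFun (fun q : Fin 2 × ℕ => θ q.1 q.2) P)
    (hlaw : ∀ i n, P.map (θ i n) = ν) :
    IsStronglyMixing (backwardShift p ω hpos hbdd)
      (P.map (randomSeries p (shiftCoeff k₀ ω) θ)) := by
  have hν1 : IsProbabilityMeasure ν :=
    hlaw 0 0 ▸ Measure.isProbabilityMeasure_map (hθ 0 0).aemeasurable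
  set N : Measure (Fin 2 × ℕ → ℝ) := Measure.infinitePi fun _ => ν
  let η : Fin 2 → ℕ → (Fin 2 × ℕ → ℝ) → ℝ := fun i n x => x (i, n)
  have hη : ∀ᵐ x ∂N, Summable fun q : Fin 2 × ℕ => |shiftCoeff k₀ ω q.2 * η q.1 q.2 x| :=
    ae_summable_abs_mul hν measurable_pi_apply
      (fun q => (measurePreserving_eval_infinitePi (fun _ => ν) q).map_eq)
      (hasSum_comp_snd hk.hasSum).summable
  have hπ := aemeasurable_randomSeries (p := p) (fun i n => measurable_pi_apply (i, n)) hη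
  have hΦ : Measurable fun s (q : Fin 2 × ℕ) => θ q.1 q.2 s :=
    measurable_pi_lambda _ fun q => hθ q.1 q.2
  have hjoint : P.map (fun s q => θ q.1 q.2 s) = N := by
    simpa only [hlaw] using hindep.map_fun_eq_infinitePi_map₀ hΦ.aemeasurable
  have hfactor : P.map (randomSeries p (shiftCoeff k₀ ω) θ) =
      N.map (randomSeries p (shiftCoeff k₀ ω) η) := by
    rw [← hjoint] at hπ ⊢
    exact (AEMeasurable.map_map_of_aemeasurable hπ hΦ.aemeasurable).symm
  have hbernoulli : IsStronglyMixing (fun x : Fin 2 × ℕ → ℝ => x ∘ Prod.map id Nat.succ) N := by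
    refine isStronglyMixing_infinitePi_comp (Function.injective_id.prodMap Nat.succ_injective)
      fun q => ?_
    filter_upwards [eventually_gt_atTop q.2] with n hn
    rintro ⟨q', rfl⟩
    simp [Prod.map_iterate, Nat.succ_iterate] at hn
  rw [hfactor]
  refine hbernoulli.map_of_ae_semiconj (ContinuousLinearMap.measurable _) hπ ?_
  filter_upwards [hη] with x hx using (backwardShift_randomSeries hpos hbdd hx).symm

end Shift

/-! ### Codifferences of the law of the series -/

theorem norm_tsum_levyExponent_codifference_le {Λ : Measure ℝ} {ι : Type*} [Fintype ι]
    (hΛ : Integrable (fun x => |x|) Λ) {r : ℝ} (hr0 : 0 ≤ r) (hr2 : r ≤ 2)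
    (hΛr : Integrable (fun x => |x| ^ r) Λ) {k : ℕ → ℝ} (hk : ∀ l, 0 ≤ k l) {n : ℕ}
    (hkr : Summable fun l => k l ^ (r / 2) * k (l + n) ^ (r / 2)) {a b : ℝ} (ha : 0 ≤ a)
    (hb : 0 ≤ b) {c d : ι × ℕ → ℝ} (hc : ∀ i l, |c (i, l)| ≤ k l * a)
    (hd0 : ∀ i, ∀ l < n, d (i, l) = 0) (hd : ∀ i l, |d (i, l + n)| ≤ k l * b) :
    ‖∑' q, (levyExponent Λ (c q - d q) - levyExponent Λ (c q) - levyExponent Λ (-d q))‖ ≤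
      Fintype.card ι * (2 ^ (2 - r) * (∫ x, |x| ^ r ∂Λ) * (a ^ (r / 2) * b ^ (r / 2)) *
        ∑' l, k l ^ (r / 2) * k (l + n) ^ (r / 2)) := by
  have hinj : Function.Injective (Prod.map id (· + n) : ι × ℕ → ι × ℕ) :=
    Function.injective_id.prodMap (add_left_injective n)
  have hsupp : ∀ q ∉ Set.range (Prod.map id (· + n) : ι × ℕ → ι × ℕ), d q = 0 := fun ⟨i, l⟩ hq =>
    hd0 i l <| not_le.1 fun h => hq ⟨(i, l - n), by simp [h]⟩
  have hterm : ∀ q : ι × ℕ, ‖levyExponent Λ (c (q.1, q.2 + n) - d (q.1, q.2 + n)) -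
      levyExponent Λ (c (q.1, q.2 + n)) - levyExponent Λ (-d (q.1, q.2 + n))‖ ≤
      2 ^ (2 - r) * (∫ x, |x| ^ r ∂Λ) * (a ^ (r / 2) * b ^ (r / 2)) *
        (k q.2 ^ (r / 2) * k (q.2 + n) ^ (r / 2)) := fun ⟨i, l⟩ => by
    have : 0 ≤ 2 ^ (2 - r) * ∫ x, |x| ^ r ∂Λ :=
      mul_nonneg (by positivity) (integral_nonneg fun x => Real.rpow_nonneg (abs_nonneg x) r)
    have hka : 0 ≤ k (l + n) * a := mul_nonneg (hk _) ha
    calc _ ≤ 2 ^ (2 - r) * (∫ x, |x| ^ r ∂Λ) *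
            (|c (i, l + n)| ^ (r / 2) * |d (i, l + n)| ^ (r / 2)) :=
          norm_levyExponent_codifference_le hΛ hr0 hr2 hΛr _ _
      _ ≤ 2 ^ (2 - r) * (∫ x, |x| ^ r ∂Λ) *
            ((k (l + n) * a) ^ (r / 2) * (k l * b) ^ (r / 2)) := by
          gcongr
          exacts [hc i _, hd i l]
      _ = _ := by
          rw [Real.mul_rpow (hk _) ha, Real.mul_rpow (hk _) hb]
          ring
  rw [← hinj.tsum_eq]
  · exact tsum_of_norm_bounded (hasSum_comp_snd (hkr.hasSum.mul_left _)) hterm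
  · refine Function.support_subset_iff'.2 fun q hq => ?_
    simp [hsupp q hq, levyExponent_zero]

section Codifference

variable {p : ℝ≥0∞} [Fact (1 ≤ p)]

section ShiftedCoefficients

variable {k₀ : ℝ} {ω : ℕ → ℝ} (hpos : ∀ n, 0 < ω n) (hbdd : BddAbove (Set.range ω))
  (M : StrongDual ℝ (SeqSpace p))

theorem seriesCoeff_comp_backwardShift_zero (k : ℕ → ℝ) (i : Fin 2) :
    seriesCoeff k (M.comp ((backwardShift p ω hpos hbdd).restrictScalars ℝ)) (i, 0) = 0 := by
  rw [seriesCoeff, ContinuousLinearMap.comp_apply, ContinuousLinearMap.coe_restrictScalars',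
    backwardShift_realSingle_zero, map_zero, mul_zero]

theorem seriesCoeff_comp_backwardShift_succ (i : Fin 2) (l : ℕ) :
    seriesCoeff (shiftCoeff k₀ ω) (M.comp ((backwardShift p ω hpos hbdd).restrictScalars ℝ))
      (i, l + 1) = seriesCoeff (shiftCoeff k₀ ω) M (i, l) := by
  rw [seriesCoeff, ContinuousLinearMap.comp_apply, ContinuousLinearMap.coe_restrictScalars',
    backwardShift_realSingle_succ, map_smul, smul_eq_mul, ← mul_assoc,
    shiftCoeff_succ_mul k₀ (hpos l).ne', seriesCoeff]

theorem seriesCoeff_comp_backwardShift_pow_of_lt (i : Fin 2) {n l : ℕ} (hl : l < n) :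
    seriesCoeff (shiftCoeff k₀ ω)
      (M.comp ((backwardShift p ω hpos hbdd ^ n).restrictScalars ℝ)) (i, l) = 0 := by
  induction n generalizing l with
  | zero => exact absurd hl l.not_lt_zero
  | succ n ih =>
    let M' := M.comp ((backwardShift p ω hpos hbdd ^ n).restrictScalars ℝ)
    cases l with
    | zero => exact seriesCoeff_comp_backwardShift_zero hpos hbdd M' _ i
    | succ l =>
      exact (seriesCoeff_comp_backwardShift_succ hpos hbdd M' i l).trans
        (ih (Nat.lt_of_succ_lt_succ hl))

theorem seriesCoeff_comp_backwardShift_pow_add (i : Fin 2) (l n : ℕ) :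
    seriesCoeff (shiftCoeff k₀ ω)
      (M.comp ((backwardShift p ω hpos hbdd ^ n).restrictScalars ℝ)) (i, l + n) =
      seriesCoeff (shiftCoeff k₀ ω) M (i, l) := by
  induction n with
  | zero => rfl
  | succ n ih =>
    exact (seriesCoeff_comp_backwardShift_succ hpos hbdd
      (M.comp ((backwardShift p ω hpos hbdd ^ n).restrictScalars ℝ)) i (l + n)).trans ih

end ShiftedCoefficients

variable {Λ : Measure ℝ} {Ω : Type*} [MeasurableSpace Ω] {P : Measure Ω} [IsProbabilityMeasure P]
  {k : ℕ → ℝ} {θ : Fin 2 → ℕ → Ω → ℝ} [MeasurableSpace (SeqSpace p)] [BorelSpace (SeqSpace p)]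

theorem logChar_codifference_randomSeries (hΛ : Integrable (fun x => |x|) Λ)
    (hk : Summable fun n => |k n|) (hθ : ∀ i n, Measurable (θ i n))
    (hindep : iIndepFun (fun q : Fin 2 × ℕ => θ q.1 q.2) P)
    (hchar : ∀ i n t, charFun (P.map (θ i n)) t = Complex.exp (levyExponent Λ t))
    (hs : ∀ᵐ s ∂P, Summable fun q : Fin 2 × ℕ => |k q.2 * θ q.1 q.2 s|)
    (L M : StrongDual ℝ (SeqSpace p)) :
    logChar (P.map (randomSeries p k θ)) (fun z => L z - M z) -
        logChar (P.map (randomSeries p k θ)) (fun z => L z) -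
        logChar (P.map (randomSeries p k θ)) (fun z => -M z) =
      ∑' q, (levyExponent Λ (seriesCoeff k L q - seriesCoeff k M q) -
        levyExponent Λ (seriesCoeff k L q) - levyExponent Λ (-seriesCoeff k M q)) := by
  have hlog : ∀ N : StrongDual ℝ (SeqSpace p), logChar (P.map (randomSeries p k θ)) N =
      ∑' q, levyExponent Λ (seriesCoeff k N q) := fun N => by
    simpa using (isLogBranch_randomSeries hΛ hk hθ hindep hchar hs N).logChar_eq
  have hsum : ∀ N : StrongDual ℝ (SeqSpace p),
      Summable fun q => levyExponent Λ (seriesCoeff k N q) :=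
    fun N => summable_levyExponent hΛ (summable_abs_seriesCoeff hk N)
  have hsub : ∀ q, seriesCoeff k (L - M) q = seriesCoeff k L q - seriesCoeff k M q :=
    fun q => mul_sub _ _ _
  have hneg : ∀ q, seriesCoeff k (-M) q = -seriesCoeff k M q := fun q => mul_neg _ _
  simp only [← hsub, ← hneg]
  rw [((hsum _).sub (hsum _)).tsum_sub (hsum _), (hsum _).tsum_sub (hsum _), ← hlog, ← hlog, ← hlog]
  rfl

theorem norm_logChar_codifference_backwardShift_le (hΛ : Integrable (fun x => |x|) Λ)
    {k₀ : ℝ} (hk₀ : 0 < k₀) {ω : ℕ → ℝ} (hpos : ∀ n, 0 < ω n) (hbdd : BddAbove (Set.range ω))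
    (hk : Summable (shiftCoeff k₀ ω)) (hθ : ∀ i n, Measurable (θ i n))
    (hindep : iIndepFun (fun q : Fin 2 × ℕ => θ q.1 q.2) P)
    (hchar : ∀ i n t, charFun (P.map (θ i n)) t = Complex.exp (levyExponent Λ t))
    (hs : ∀ᵐ s ∂P, Summable fun q : Fin 2 × ℕ => |shiftCoeff k₀ ω q.2 * θ q.1 q.2 s|)
    {r : ℝ} (hr0 : 0 ≤ r) (hr2 : r ≤ 2) (hΛr : Integrable (fun x => |x| ^ r) Λ) {n : ℕ}
    (hkr : Summable fun l => shiftCoeff k₀ ω l ^ (r / 2) * shiftCoeff k₀ ω (l + n) ^ (r / 2))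
    (L M : StrongDual ℝ (SeqSpace p)) :
    ‖logChar (P.map (randomSeries p (shiftCoeff k₀ ω) θ))
          (fun z => L z - M ((backwardShift p ω hpos hbdd ^ n) z)) -
        logChar (P.map (randomSeries p (shiftCoeff k₀ ω) θ)) (fun z => L z) -
        logChar (P.map (randomSeries p (shiftCoeff k₀ ω) θ))
          (fun z => -M ((backwardShift p ω hpos hbdd ^ n) z))‖ ≤
      2 ^ (3 - r) * (∫ x, |x| ^ r ∂Λ) * (‖L‖ ^ (r / 2) * ‖M‖ ^ (r / 2)) *
        ∑' l, shiftCoeff k₀ ω l ^ (r / 2) * shiftCoeff k₀ ω (l + n) ^ (r / 2) := by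
  have hk0 : ∀ l, 0 ≤ shiftCoeff k₀ ω l := fun l => (shiftCoeff_pos hk₀ hpos l).le
  have hbound : ∀ (N : StrongDual ℝ (SeqSpace p)) i l,
      |seriesCoeff (shiftCoeff k₀ ω) N (i, l)| ≤ shiftCoeff k₀ ω l * ‖N‖ := fun N i l => by
    simpa only [abs_of_nonneg (hk0 l)] using abs_seriesCoeff_le (shiftCoeff k₀ ω) N (i, l)
  have hcodiff := logChar_codifference_randomSeries hΛ hk.abs hθ hindep hchar hs L
    (M.comp ((backwardShift p ω hpos hbdd ^ n).restrictScalars ℝ))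
  have hle := norm_tsum_levyExponent_codifference_le hΛ hr0 hr2 hΛr hk0 hkr (norm_nonneg L)
    (norm_nonneg M) (hbound L)
    (fun i l hl => seriesCoeff_comp_backwardShift_pow_of_lt hpos hbdd M i hl)
    fun i l => (seriesCoeff_comp_backwardShift_pow_add hpos hbdd M i l n).symm ▸ hbound M i l
  rw [← hcodiff] at hle
  refine hle.trans_eq ?_
  rw [show (3 : ℝ) - r = 1 + (2 - r) by ring, Real.rpow_add two_pos, Real.rpow_one,
    Fintype.card_fin]
  push_cast
  ring

end Codifference

/-! ### Invariance, mixing and codifference bounds -/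

theorem summable_rpow_of_summable_rpow {k : ℕ → ℝ} (hk0 : ∀ n, 0 ≤ k n) {a b : ℝ} (ha : 0 < a)
    (hab : a ≤ b) (hk : Summable fun n => k n ^ a) : Summable fun n => k n ^ b := by
  refine Summable.of_norm_bounded_eventually_nat hk ?_
  filter_upwards [hk.tendsto_atTop_zero.eventually_lt_const one_pos] with n hn
  have h1 : k n ≤ 1 := by
    by_contra! h
    exact hn.not_ge (Real.one_le_rpow h.le ha.le)
  rw [Real.norm_of_nonneg (Real.rpow_nonneg (hk0 n) b)]
  rcases (hk0 n).eq_or_lt with h0 | h0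
  · rw [← h0, Real.zero_rpow ha.ne', Real.zero_rpow (ha.trans_le hab).ne']
  · exact Real.rpow_le_rpow_of_exponent_ge h0 h1 hab

theorem summable_rpow_half_mul_shift {k : ℕ → ℝ} (hk0 : ∀ n, 0 ≤ k n) {r : ℝ}
    (hk : Summable fun n => k n ^ r) (n : ℕ) :
    Summable fun l => k l ^ (r / 2) * k (l + n) ^ (r / 2) := by
  have hsq : ∀ l, (k l ^ (r / 2)) ^ 2 = k l ^ r := fun l => by
    rw [← Real.rpow_natCast, ← Real.rpow_mul (hk0 l)]
    norm_num
  refine Summable.of_nonneg_of_le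
    (fun l => mul_nonneg (Real.rpow_nonneg (hk0 _) _) (Real.rpow_nonneg (hk0 _) _)) (fun l => ?_)
    (hk.add ((summable_nat_add_iff (f := fun l => k l ^ r) n).2 hk))
  rw [← hsq, ← hsq]
  nlinarith [sq_nonneg (k l ^ (r / 2) - k (l + n) ^ (r / 2)), sq_nonneg (k l ^ (r / 2)),
    sq_nonneg (k (l + n) ^ (r / 2))]

section Functionals

variable {E : Type*} [NormedAddCommGroup E] [NormedSpace ℂ E]

/-- The real part of a complex functional. -/
noncomputable def reFunctional (x : StrongDual ℂ E) : StrongDual ℝ E :=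
  Complex.reCLM.comp (x.restrictScalars ℝ)

/-- The imaginary part of a complex functional. -/
noncomputable def imFunctional (x : StrongDual ℂ E) : StrongDual ℝ E :=
  Complex.imCLM.comp (x.restrictScalars ℝ)

theorem norm_reFunctional_le (x : StrongDual ℂ E) : ‖reFunctional x‖ ≤ ‖x‖ :=
  ContinuousLinearMap.opNorm_le_bound _ (norm_nonneg _) fun z =>
    (Complex.abs_re_le_norm (x z)).trans (x.le_opNorm z)

theorem norm_imFunctional_le (x : StrongDual ℂ E) : ‖imFunctional x‖ ≤ ‖x‖ :=
  ContinuousLinearMap.opNorm_le_bound _ (norm_nonneg _) fun z =>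
    (Complex.abs_im_le_norm (x z)).trans (x.le_opNorm z)

end Functionals

section Main

variable {Λ : Measure ℝ} {p : ℝ≥0∞} [Fact (1 ≤ p)] {Ω : Type*} [MeasurableSpace Ω] {P : Measure Ω}
  [IsProbabilityMeasure P] {θ : Fin 2 → ℕ → Ω → ℝ}

theorem map_eq_map_of_charFun_eq (hchar : ∀ i n t,
    charFun (P.map (θ i n)) t = Complex.exp (levyExponent Λ t)) (hθ : ∀ i n, Measurable (θ i n))
    (i : Fin 2) (n : ℕ) : P.map (θ i n) = P.map (θ 0 0) := by
  have := fun i n => Measure.isProbabilityMeasure_map (μ := P) (hθ i n).aemeasurable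
  exact Measure.ext_of_charFun (funext fun t => by rw [hchar, hchar])

variable [MeasurableSpace (SeqSpace p)] [BorelSpace (SeqSpace p)]

theorem proposition6p4_general [SFinite Λ] (hΛ : Integrable (fun x => |x|) Λ)
    {ω : ℕ → ℝ} (hpos : ∀ n, 0 < ω n) (hbdd : BddAbove (Set.range ω)) {k₀ : ℝ} (hk₀ : 0 < k₀)
    (hk : Summable (shiftCoeff k₀ ω)) (hθ : ∀ i n, Measurable (θ i n))
    (hindep : iIndepFun (fun q : Fin 2 × ℕ => θ q.1 q.2) P)
    (hchar : ∀ i n t, charFun (P.map (θ i n)) t = Complex.exp (levyExponent Λ t)) :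
    let k : ℕ → ℝ := shiftCoeff k₀ ω
    let X : Ω → SeqSpace p := randomSeries p k θ
    let μ : Measure (SeqSpace p) := P.map X
    let T : SeqSpace p →L[ℂ] SeqSpace p := backwardShift p ω hpos hbdd
    ((∀ᵐ s ∂P, Summable (seriesTerm p k θ s)) ∧ AEMeasurable X P) ∧
    (∀ x : StrongDual ℂ (SeqSpace p), ∃ L, IsLogBranch (charPath μ fun z => (x z).re) L) ∧
    (∀ r : ℝ, 0 ≤ r → r ≤ 2 → Integrable (fun x => |x| ^ r) Λ → Summable (fun n => k n ^ r) →
      ∀ n : ℕ, Summable (fun l => k l ^ (r / 2) * k (l + n) ^ (r / 2)) ∧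
        ∀ x y : StrongDual ℂ (SeqSpace p),
          ‖codiffEq μ x (y.comp (T ^ n))‖ ≤ 2 ^ (3 - r) * (∫ x, |x| ^ r ∂Λ) *
            (‖x‖ ^ (r / 2) * ‖y‖ ^ (r / 2)) * ∑' l, k l ^ (r / 2) * k (l + n) ^ (r / 2) ∧
          ‖codiffNe μ x (y.comp (T ^ n))‖ ≤ 2 ^ (3 - r) * (∫ x, |x| ^ r ∂Λ) *
            (‖x‖ ^ (r / 2) * ‖y‖ ^ (r / 2)) * ∑' l, k l ^ (r / 2) * k (l + n) ^ (r / 2)) ∧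
    IsStronglyMixing T μ := by
  intro k X μ T
  have hk0 : ∀ n, 0 ≤ k n := fun n => (shiftCoeff_pos hk₀ hpos n).le
  have hlaw := map_eq_map_of_charFun_eq hchar hθ
  have hprob := Measure.isProbabilityMeasure_map (μ := P) (hθ 0 0).aemeasurable
  have hν : Integrable (fun x => x) (P.map (θ 0 0)) :=
    integrable_id_of_charFun_eq_exp_levyExponent hΛ (hchar 0 0)
  have hs : ∀ᵐ s ∂P, Summable fun q : Fin 2 × ℕ => |k q.2 * θ q.1 q.2 s| :=
    ae_summable_abs_mul hν (fun q => hθ q.1 q.2) (fun q => hlaw q.1 q.2)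
      (hasSum_comp_snd hk.hasSum).summable.abs
  refine ⟨⟨?_, aemeasurable_randomSeries hθ hs⟩, fun x => ⟨_, isLogBranch_randomSeries hΛ hk.abs hθ
    hindep hchar hs (reFunctional x)⟩, fun r hr0 hr2 hΛr hkr n => ?_,
    isStronglyMixing_randomSeries hpos hbdd hν hk.abs hθ hindep hlaw⟩
  · filter_upwards [hs] with s hs using (hasSum_seriesTerm (hasSum_randomSeries hs)).summable
  have hkrn := summable_rpow_half_mul_shift hk0 hkr n
  refine ⟨hkrn, fun x y => ?_⟩
  have hbound : ∀ a b, 0 ≤ a → 0 ≤ b → a ≤ ‖x‖ → b ≤ ‖y‖ →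
      2 ^ (3 - r) * (∫ x, |x| ^ r ∂Λ) * (a ^ (r / 2) * b ^ (r / 2)) *
        ∑' l, k l ^ (r / 2) * k (l + n) ^ (r / 2) ≤
      2 ^ (3 - r) * (∫ x, |x| ^ r ∂Λ) * (‖x‖ ^ (r / 2) * ‖y‖ ^ (r / 2)) *
        ∑' l, k l ^ (r / 2) * k (l + n) ^ (r / 2) := fun a b ha hb hax hby => by
    have : 0 ≤ ∫ x, |x| ^ r ∂Λ := integral_nonneg fun x => Real.rpow_nonneg (abs_nonneg x) r
    have hS : 0 ≤ ∑' l, k l ^ (r / 2) * k (l + n) ^ (r / 2) := tsum_nonneg fun l =>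
      mul_nonneg (Real.rpow_nonneg (hk0 _) _) (Real.rpow_nonneg (hk0 _) _)
    gcongr
  have hcodiff := norm_logChar_codifference_backwardShift_le hΛ hk₀ hpos hbdd hk hθ hindep hchar hs
    hr0 hr2 hΛr hkrn (reFunctional x)
  exact ⟨(hcodiff (reFunctional y)).trans (hbound _ _ (norm_nonneg _) (norm_nonneg _)
    (norm_reFunctional_le x) (norm_reFunctional_le y)),
    (hcodiff (imFunctional y)).trans (hbound _ _ (norm_nonneg _) (norm_nonneg _)
    (norm_reFunctional_le x) (norm_imFunctional_le y))⟩

end Main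

theorem div_le_of_le_two_rpow_mul {c m u S r : ℝ} (hm : 0 ≤ m) (hu : 0 ≤ u) (hS : 0 ≤ S)
    (h : c ≤ 2 ^ (3 - r) * m * u * S) : c / u ≤ 2 ^ (5 - r) * m * S := by
  refine div_le_of_le_mul₀ hu (by positivity) (h.trans ?_)
  calc 2 ^ (3 - r) * m * u * S ≤ 2 ^ (5 - r) * m * u * S := by
        gcongr
        · exact one_le_two
        · norm_num
    _ = _ := by ring

theorem proposition6p4
    (α : ℝ) (hα0 : 0 < α) (hα1 : α < 1)
    (p : ℝ≥0∞) [Fact (1 ≤ p)] (hp2 : p ≤ 2)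
    (aNeg aPos lNeg lPos : ℝ) (ham : 0 < aNeg) (hap : 0 < aPos) (hlm : 0 < lNeg) (hlp : 0 < lPos)
    (ω : ℕ → ℝ) (hpos : ∀ n, 0 < ω n) (hbdd : BddAbove (Set.range ω))
    (k₀ : ℝ) (hk₀ : 0 < k₀)
    (hk : Summable fun n => shiftCoeff k₀ ω n ^ α)
    {Ω : Type*} [MeasurableSpace Ω] (P : Measure Ω) [IsProbabilityMeasure P]
    (θ : Fin 2 → ℕ → Ω → ℝ) (hθ : ∀ i n, Measurable (θ i n))
    (hindep : iIndepFun (fun q : Fin 2 × ℕ => θ q.1 q.2) P)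
    (hlaw : ∀ i n, IsTemperedStable α aNeg aPos lNeg lPos (P.map (θ i n)))
    [MeasurableSpace (SeqSpace p)] [BorelSpace (SeqSpace p)] :
    let k : ℕ → ℝ := shiftCoeff k₀ ω
    let X : Ω → SeqSpace p := randomSeries p k θ
    let μ : Measure (SeqSpace p) := P.map X
    let T : SeqSpace p →L[ℂ] SeqSpace p := backwardShift p ω hpos hbdd
    -- the random series converges in `ℓ^p(ℕ)` almost surely, and `μ` is its law
    ((∀ᵐ s ∂P, Summable (seriesTerm p k θ s)) ∧ AEMeasurable X P) ∧
    -- the logarithms in the codifferences of `μ` exist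
    (∀ x : StrongDual ℂ (SeqSpace p), ∃ L, IsLogBranch (charPath μ fun z => (x z).re) L) ∧
    -- `μ` is invariant under `T`
    MeasurePreserving T μ μ ∧
    -- the codifference bounds, for all `n ≥ 0`
    (∀ n : ℕ,
      Summable (fun l => k l ^ (p.toReal / 2) * k (l + n) ^ (p.toReal / 2)) ∧
      ∀ x y : StrongDual ℂ (SeqSpace p), x ≠ 0 → y ≠ 0 →
        ‖codiffEq μ x (y.comp (T ^ n))‖ / (‖x‖ ^ (p.toReal / 2) * ‖y‖ ^ (p.toReal / 2)) ≤
          2 ^ (5 - p.toReal) * (aNeg * lNeg ^ (α - p.toReal) + aPos * lPos ^ (α - p.toReal))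
            * Real.Gamma (p.toReal - α)
            * ∑' l, k l ^ (p.toReal / 2) * k (l + n) ^ (p.toReal / 2) ∧
        ‖codiffNe μ x (y.comp (T ^ n))‖ / (‖x‖ ^ (p.toReal / 2) * ‖y‖ ^ (p.toReal / 2)) ≤
          2 ^ (5 - p.toReal) * (aNeg * lNeg ^ (α - p.toReal) + aPos * lPos ^ (α - p.toReal))
            * Real.Gamma (p.toReal - α)
            * ∑' l, k l ^ (p.toReal / 2) * k (l + n) ^ (p.toReal / 2)) ∧
    -- mixing
    (Tendsto (fun n : ℕ => ∑' l, k l ^ (p.toReal / 2) * k (l + n) ^ (p.toReal / 2))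
        atTop (𝓝 0) → IsStronglyMixing T μ) := by
  intro k X μ T
  have h1p : 1 ≤ p.toReal := by
    simpa using ENNReal.toReal_mono (hp2.trans_lt ENNReal.ofNat_lt_top).ne (Fact.out : 1 ≤ p)
  have hp2' : p.toReal ≤ 2 := by simpa using ENNReal.toReal_mono ENNReal.ofNat_ne_top hp2
  have hk0 : ∀ n, 0 ≤ k n := fun n => (shiftCoeff_pos hk₀ hpos n).le
  have hint : ∀ q, α < q →
      Integrable (fun x => |x| ^ q) (temperedStableLevy α aNeg aPos lNeg lPos) := fun q hq =>
    integrable_abs_rpow_temperedStableLevy ham.le hap.le hlm hlp hq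
  have hkq : ∀ q, α < q → Summable fun n => k n ^ q := fun q hq =>
    summable_rpow_of_summable_rpow hk0 hα0 hq.le hk
  have hαp : α < p.toReal := hα1.trans_le h1p
  obtain ⟨hconv, hlog, hcodiff, hmix⟩ := proposition6p4_general (p := p)
    (by simpa using hint 1 hα1) hpos hbdd hk₀ (by simpa using hkq 1 hα1) hθ hindep
    fun i n => (hlaw i n).2
  refine ⟨hconv, hlog, hmix.1, fun n => ?_, fun _ => hmix⟩
  obtain ⟨hsum, hle⟩ := hcodiff p.toReal (by linarith) hp2' (hint _ hαp) (hkq _ hαp) n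
  refine ⟨hsum, fun x y _ _ => ?_⟩
  rw [mul_assoc (2 ^ _), ← integral_abs_rpow_temperedStableLevy ham.le hap.le hlm hlp hαp]
  have hm : 0 ≤ ∫ x, |x| ^ p.toReal ∂temperedStableLevy α aNeg aPos lNeg lPos :=
    integral_nonneg fun x => Real.rpow_nonneg (abs_nonneg x) _
  have hS : 0 ≤ ∑' l, k l ^ (p.toReal / 2) * k (l + n) ^ (p.toReal / 2) :=
    tsum_nonneg fun l => mul_nonneg (Real.rpow_nonneg (hk0 _) _) (Real.rpow_nonneg (hk0 _) _)
  exact (hle x y).imp (div_le_of_le_two_rpow_mul hm (by positivity) hS)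
    (div_le_of_le_two_rpow_mul hm (by positivity) hS)
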